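/- Let $k$ be a commutative ring. A Grothendieck $k$-linear category is a $k$-linear abelian category with small colimits, exact filtered colimits and a generator. Let $\mathsf{Grt}_{\mathsf{flat}}$ be the $2$-category whose objects are the Grothendieck $k$-linear categories, whose $1$-cells $f\colon \mathcal A\to\mathcal B$ (flat morphisms) are the adjunctions $f^*\colon \mathcal B\rightleftarrows \mathcal A\colon f_*$ of $k$-linear functors with exact left adjoint $f^*$, and whose $2$-cells $f\Rightarrow g$ are the natural transformations $f^*\Rightarrow g^*$. Let $\mathsf{Cat}_k$ be the $2$-category of $k$-linear categories, $k$-linear functors and natural transformations. For a small $k$-linear category $\mathfrak a$ let $\mathrm{Mod}(\mathfrak a)$ be the category of $k$-linear functors $\mathfrak a^{\mathrm{op}}\to \mathrm{Mod}(k)$, and let $\mathsf{fpmod}(k)$ be (a small version of) the category of finitely presented $k$-modules. Then the forgetful $2$-functor $$U\colon \mathsf{Grt}_{\mathsf{flat}}^{\mathrm{op}}\longrightarrow \mathsf{Cat}_k,\qquad U(\mathcal A)=\mathcal A,\quad U(f)=f^*,$$ is representable, and it is represented by the Grothendieck category $\mathrm{Mod}(k)[\mathbb O]:=\mathrm{Mod}(\mathsf{fpmod}(k)^{\mathrm{op}})$: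 there is a pseudonatural equivalence $$\mathsf{Grt}_{\mathsf{flat}}\bigl(-,\mathrm{Mod}(k)[\mathbb O]\bigr)\simeq U$$ of $2$-functors $\mathsf{Grt}_{\mathsf{flat}}^{\mathrm{op}}\to\mathsf{Cat}_k$. In particular, for every Grothendieck $k$-linear category $\mathcal A$ the $k$-linear category of flat morphisms $\mathcal A\to \mathrm{Mod}(k)[\mathbb O]$ is equivalent to $\mathcal A$. -/

import Mathlib

universe w v u v₁ v₂ v₃ u₁ u₂ u₃

open CategoryTheory CategoryTheory.Limits Opposite
open scoped CategoryTheory.Bicategory CategoryTheory.Pseudofunctor.StrongTrans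

namespace LinearCat

section Basic

variable (k : Type u) [CommRing k]

/-- The opposite of a `k`-linear category is `k`-linear. -/
instance linearOpposite (C : Type u₁) [Category.{v₁} C] [Preadditive C] [Linear k C] :
    Linear k Cᵒᵖ where
  homModule X Y := Equiv.module k (opEquiv X Y)
  smul_comp _ _ _ r f g := Quiver.Hom.unop_inj (Linear.comp_smul _ _ _ g.unop r f.unop)
  comp_smul _ _ _ f r g := Quiver.Hom.unop_inj (Linear.smul_comp _ _ _ r g.unop f.unop)

/-- The property of a functor between `k`-linear categories of being `k`-linear: it acts on
morphisms by additive maps which commute with scalars. -/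
def linFunctor (C : Type u₁) (D : Type u₂) [Category.{v₁} C] [Category.{v₂} D]
    [Preadditive C] [Preadditive D] [Linear k C] [Linear k D] : ObjectProperty (C ⥤ D) :=
  fun F => F.Additive ∧ F.Linear k

/-- The category of `k`-linear functors and natural transformations. -/
abbrev LinFunctor (C : Type u₁) (D : Type u₂) [Category.{v₁} C] [Category.{v₂} D]
    [Preadditive C] [Preadditive D] [Linear k C] [Linear k D] :=
  (linFunctor k C D).FullSubcategory

section Closure
variable (C : Type u₁) (D : Type u₂) [Category.{v₁} C] [Category.{v₂} D]
    [Preadditive C] [Preadditive D] [Linear k C] [Linear k D] (J : Type u₃) [Category.{v₃} J]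

instance linFunctor_closedUnderLimits [HasLimitsOfShape J D] :
    (linFunctor k C D).IsClosedUnderLimitsOfShape J where
  limitsOfShape_le := by
    rintro F ⟨p⟩
    have hl (X : C) := isLimitOfPreserves ((evaluation C D).obj X) p.isLimit
    have h1 (j : J) : (p.diag.obj j).Additive := (p.prop_diag_obj j).1
    have h2 (j : J) : (p.diag.obj j).Linear k := (p.prop_diag_obj j).2
    have hn {X Y : C} (j : J) (f : X ⟶ Y) :
        F.map f ≫ (p.π.app j).app Y = (p.π.app j).app X ≫ (p.diag.obj j).map f :=
      (p.π.app j).naturality f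
    refine ⟨⟨fun {X Y f g} => (hl Y).hom_ext fun j => ?_⟩,
      ⟨fun {X Y} f r => (hl Y).hom_ext fun j => ?_⟩⟩
    · change F.map (f + g) ≫ (p.π.app j).app Y = (F.map f + F.map g) ≫ (p.π.app j).app Y
      rw [Preadditive.add_comp, hn, hn, hn, (p.diag.obj j).map_add, Preadditive.comp_add]
    · change F.map (r • f) ≫ (p.π.app j).app Y = (r • F.map f) ≫ (p.π.app j).app Y
      rw [Linear.smul_comp, hn, hn, (p.diag.obj j).map_smul, Linear.comp_smul]

instance linFunctor_closedUnderColimits [HasColimitsOfShape J D] :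
    (linFunctor k C D).IsClosedUnderColimitsOfShape J where
  colimitsOfShape_le := by
    rintro F ⟨p⟩
    have hl (X : C) := isColimitOfPreserves ((evaluation C D).obj X) p.isColimit
    have h1 (j : J) : (p.diag.obj j).Additive := (p.prop_diag_obj j).1
    have h2 (j : J) : (p.diag.obj j).Linear k := (p.prop_diag_obj j).2
    have hn {X Y : C} (j : J) (f : X ⟶ Y) :
        (p.diag.obj j).map f ≫ (p.ι.app j).app Y = (p.ι.app j).app X ≫ F.map f :=
      (p.ι.app j).naturality f
    refine ⟨⟨fun {X Y f g} => (hl X).hom_ext fun j => ?_⟩,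
      ⟨fun {X Y} f r => (hl X).hom_ext fun j => ?_⟩⟩
    · change (p.ι.app j).app X ≫ F.map (f + g) = (p.ι.app j).app X ≫ (F.map f + F.map g)
      rw [Preadditive.comp_add, ← hn, ← hn, ← hn, (p.diag.obj j).map_add, Preadditive.add_comp]
    · change (p.ι.app j).app X ≫ F.map (r • f) = (p.ι.app j).app X ≫ (r • F.map f)
      rw [Linear.comp_smul, ← hn, ← hn, (p.diag.obj j).map_smul, Linear.smul_comp]
end Closure

/-- The category `Mod(𝔞)` of (right) modules over a small `k`-linear category `𝔞`: the `k`-linear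
presheaves on `𝔞` with values in `Mod(k)`. -/
abbrev Modules (𝔞 : Type u) [Category.{u} 𝔞] [Preadditive 𝔞] [Linear k 𝔞] :=
  LinFunctor k 𝔞ᵒᵖ (ModuleCat.{u} k)

section
variable (𝔞 : Type u) [Category.{u} 𝔞] [Preadditive 𝔞] [Linear k 𝔞]

instance : (linFunctor k 𝔞ᵒᵖ (ModuleCat.{u} k)).IsClosedUnderFiniteProducts where

instance : (linFunctor k 𝔞ᵒᵖ (ModuleCat.{u} k)).ContainsZero where
  exists_zero := ⟨⊤_ _, terminalIsTerminal.isZero,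
    ObjectProperty.prop_terminal _⟩

instance : (linFunctor k 𝔞ᵒᵖ (ModuleCat.{u} k)).IsClosedUnderKernels where
  kernels_le := by
    rintro _ ⟨f, c, hc, hf⟩
    exact ObjectProperty.prop_of_isLimit _ hc (by rintro (_ | _); exacts [hf.1, hf.2])

instance : (linFunctor k 𝔞ᵒᵖ (ModuleCat.{u} k)).IsClosedUnderCokernels where
  cokernels_le := by
    rintro _ ⟨f, c, hc, hf⟩
    exact ObjectProperty.prop_of_isColimit _ hc (by rintro (_ | _); exacts [hf.1, hf.2])

noncomputable instance : Abelian (Modules k 𝔞) := inferInstance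

/-- The representable module on an object. -/
def yonedaObj (X : 𝔞) : Modules k 𝔞 where
  obj := (linearYoneda k 𝔞).obj X
  property := ⟨inferInstance, ⟨fun {Y Z} f r => by
    ext g
    exact Linear.smul_comp _ _ _ r f.unop g⟩⟩

instance : HasColimitsOfSize.{u, u} (Modules k 𝔞) where
  has_colimits_of_shape _ _ := inferInstance

/-- The morphism out of a representable module which an element of a module determines. -/
def yonedaLift (F : Modules k 𝔞) (X : 𝔞) (x : F.obj.obj (op X)) : yonedaObj k 𝔞 X ⟶ F :=
  haveI := F.property.1
  haveI := F.property.2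
  ObjectProperty.homMk
    { app := fun Y => ModuleCat.ofHom (Y := F.obj.obj Y)
        { toFun := fun (t : Y.unop ⟶ X) => F.obj.map t.op x
          map_add' := fun s t => by
            rw [op_add, F.obj.map_add]; rfl
          map_smul' := fun r t => by
            change F.obj.map (r • t.op) x = r • F.obj.map t.op x
            rw [F.obj.map_smul]; rfl }
      naturality := fun Y Z f => by
        ext (t : Y.unop ⟶ X)
        change F.obj.map (t.op ≫ f) x = F.obj.map f (F.obj.map t.op x)
        rw [F.obj.map_comp]; rfl }

instance : HasSeparator (Modules k 𝔞) where
  hasSeparator := ⟨∐ (yonedaObj k 𝔞), (isSeparator_sigma _).2 fun F G f g h => by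
    ext X x
    have h' := h _ (ObjectProperty.ofObj_apply _ X.unop) (yonedaLift k 𝔞 F X.unop x)
    have h2 := congr($(h').hom.app X (𝟙 X.unop))
    change f.hom.app X (F.obj.map (𝟙 X) x) = g.hom.app X (F.obj.map (𝟙 X) x) at h2
    rwa [F.obj.map_id] at h2⟩

instance : PreservesFiniteLimits (linFunctor k 𝔞ᵒᵖ (ModuleCat.{u} k)).ι where
  preservesFiniteLimits _ _ _ := inferInstance

instance : IsGrothendieckAbelian.{u} (Modules k 𝔞) where
  ab5OfSize := ⟨fun J _ _ =>
    haveI : ReflectsFiniteLimits (linFunctor k 𝔞ᵒᵖ (ModuleCat.{u} k)).ι :=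
      ⟨fun _ _ _ => inferInstance⟩
    HasExactColimitsOfShape.domain_of_functor J (linFunctor k 𝔞ᵒᵖ (ModuleCat.{u} k)).ι⟩

end
end Basic

section FinPres

variable (k : Type u) [CommRing k]

/-- A finitely presented `k`-module in the form `kⁿ / N` with `N` finitely generated. -/
structure FinPres where
  n : ℕ
  N : Submodule k (Fin n → k)
  fg : N.FG

/-- The module `kⁿ / N`. -/
def FinPres.module (p : FinPres k) : ModuleCat.{u} k := ModuleCat.of k ((Fin p.n → k) ⧸ p.N)

/-- A small version of the category `fpmod(k)` of finitely presented `k`-modules: the full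
subcategory of `Mod(k)` on the modules `kⁿ / N` with `N` finitely generated. By `FpMod.toFull` it is
equivalent to the full subcategory of all finitely presented modules. -/
abbrev FpMod := InducedCategory (ModuleCat.{u} k) (FinPres.module k)

/-- The property of being a finitely presented module. -/
def isFinPres : ObjectProperty (ModuleCat.{u} k) := fun M => Module.FinitePresentation k M

lemma FinPres.finitePresentation (p : FinPres k) : isFinPres k (p.module k) :=
  Module.finitePresentation_of_surjective p.N.mkQ p.N.mkQ_surjective (by
    have h : p.N.mkQ.ker.FG := by rw [Submodule.ker_mkQ]; exact p.fg
    exact h)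

/-- The inclusion into the full subcategory of all finitely presented modules; it is an
equivalence of categories, see the instance below. -/
def FpMod.toFull : FpMod k ⥤ (isFinPres k).FullSubcategory :=
  (isFinPres k).lift (inducedFunctor _) (FinPres.finitePresentation k)

instance : (FpMod.toFull k).IsEquivalence where
  faithful := ⟨fun {X Y f g} h => by
    ext1
    exact congr($(h).hom)⟩
  full := ⟨fun {X Y} f => ⟨InducedCategory.homMk f.hom, rfl⟩⟩
  essSurj := ⟨fun M => by
    have : Module.FinitePresentation k M.obj := M.property
    obtain ⟨n, K, e, hK⟩ := Module.FinitePresentation.exists_fin k M.obj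
    exact ⟨(⟨n, K, hK⟩ : FinPres k), ⟨(isFinPres k).isoMk (LinearEquiv.toModuleIso e.symm)⟩⟩⟩

end FinPres

section Cat

lemma id_comp_id {C : Type u₁} [Category.{v₁} C] {X Y : C} (f : X ⟶ Y) :
    𝟙 X ≫ f ≫ 𝟙 Y = f := by simp

lemma id_comp_five {C : Type u₁} [Category.{v₁} C] {X : C} {f : X ⟶ X} (h : f = 𝟙 X) :
    𝟙 X ≫ f ≫ 𝟙 X ≫ 𝟙 X ≫ 𝟙 X = 𝟙 X := by simp [h]

lemma id_comp_three {C : Type u₁} [Category.{v₁} C] {X : C} {f : X ⟶ X} (h : f = 𝟙 X) :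
    𝟙 X ≫ f ≫ 𝟙 X = 𝟙 X := by simp [h]

/-- The objects of the 2-category `Cat_k`: the `k`-linear categories. -/
structure LinCat (k : Type u) [CommRing k] where
  carrier : Type w
  [category : Category.{v} carrier]
  [preadditive : Preadditive carrier]
  [linear : Linear k carrier]

attribute [instance] LinCat.category LinCat.preadditive LinCat.linear

variable (k : Type u) [CommRing k]

section
variable {A : Type*} {B : Type*} {C : Type*} {D : Type*} {E : Type*}
  [Category* A] [Category* B] [Category* C] [Category* D] [Category* E]
  [Preadditive A] [Preadditive B] [Preadditive C] [Preadditive D] [Preadditive E]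
  [Linear k A] [Linear k B] [Linear k C] [Linear k D] [Linear k E]

instance (F : LinFunctor k A B) : F.obj.Additive := F.property.1
instance (F : LinFunctor k A B) : F.obj.Linear k := F.property.2

/-- Bundle a `k`-linear functor. -/
abbrev LinFunctor.mk (F : A ⥤ B) [F.Additive] [F.Linear k] : LinFunctor k A B :=
  ⟨F, inferInstance, inferInstance⟩

/-- The identity functor. -/
abbrev LinFunctor.id (A : Type*) [Category* A] [Preadditive A] [Linear k A] : LinFunctor k A A :=
  LinFunctor.mk k (𝟭 A)

variable {k}

/-- Composition of `k`-linear functors. -/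
abbrev LinFunctor.comp (F : LinFunctor k A B) (G : LinFunctor k B C) : LinFunctor k A C :=
  LinFunctor.mk k (F.obj ⋙ G.obj)

/-- Left whiskering. -/
abbrev LinFunctor.whiskerLeft (F : LinFunctor k A B) {G H : LinFunctor k B C} (η : G ⟶ H) :
    F.comp G ⟶ F.comp H :=
  ObjectProperty.homMk (Functor.whiskerLeft F.obj η.hom)

/-- Right whiskering. -/
abbrev LinFunctor.whiskerRight {F G : LinFunctor k A B} (η : F ⟶ G) (H : LinFunctor k B C) :
    F.comp H ⟶ G.comp H :=
  ObjectProperty.homMk (Functor.whiskerRight η.hom H.obj)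

/-- The associator. -/
abbrev LinFunctor.assoc (F : LinFunctor k A B) (G : LinFunctor k B C) (H : LinFunctor k C D) :
    (F.comp G).comp H ≅ F.comp (G.comp H) :=
  ObjectProperty.isoMk _ (Functor.associator F.obj G.obj H.obj)

/-- The left unitor. -/
abbrev LinFunctor.leftUnitor (F : LinFunctor k A B) : (LinFunctor.id k A).comp F ≅ F :=
  ObjectProperty.isoMk _ F.obj.leftUnitor

/-- The right unitor. -/
abbrev LinFunctor.rightUnitor (F : LinFunctor k A B) : F.comp (LinFunctor.id k B) ≅ F :=
  ObjectProperty.isoMk _ F.obj.rightUnitor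

lemma LinFunctor.hom_ext {F G : LinFunctor k A B} {f g : F ⟶ G}
    (h : ∀ X, f.hom.app X = g.hom.app X) : f = g := by
  ext1; ext X; exact h X
end

/-- The 2-category `Cat_k` of `k`-linear categories, `k`-linear functors and natural
transformations (a natural transformation of `k`-linear functors is automatically `k`-linear). -/
instance : Bicategory (LinCat.{w, v, u} k) where
  Hom A B := LinFunctor k A.carrier B.carrier
  id A := LinFunctor.id k A.carrier
  comp F G := F.comp G
  homCategory A B := inferInstanceAs (Category (LinFunctor k A.carrier B.carrier))
  whiskerLeft F _ _ η := F.whiskerLeft η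
  whiskerRight η H := LinFunctor.whiskerRight η H
  associator F G H := F.assoc G H
  leftUnitor F := F.leftUnitor
  rightUnitor F := F.rightUnitor
  whiskerLeft_id _ _ := LinFunctor.hom_ext fun X => by simp
  whiskerLeft_comp _ _ _ _ _ _ := LinFunctor.hom_ext fun X => by simp
  id_whiskerLeft _ := LinFunctor.hom_ext fun X => by simp
  comp_whiskerLeft _ _ _ _ _ := LinFunctor.hom_ext fun X => by simp
  id_whiskerRight _ _ := LinFunctor.hom_ext fun X => by simp
  comp_whiskerRight _ _ _ := LinFunctor.hom_ext fun X => by simp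
  whiskerRight_id _ := LinFunctor.hom_ext fun X => by simp
  whiskerRight_comp _ _ _ := LinFunctor.hom_ext fun X => by simp
  whisker_assoc _ _ _ _ _ := LinFunctor.hom_ext fun X => by simp
  whisker_exchange _ _ := LinFunctor.hom_ext fun X => by simp
  pentagon _ _ _ _ := LinFunctor.hom_ext fun X => by simp
  triangle _ _ := LinFunctor.hom_ext fun X => by simp

/-- The objects of the 2-category `Grt_flat`: the `k`-linear Grothendieck categories, that is, the
`k`-linear abelian categories with exact filtered colimits and a generator. They are locally small
with respect to the universe of `k`. -/
structure GrtFlat (k : Type u) [CommRing k] where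
  carrier : Type (u + 1)
  [category : Category.{u} carrier]
  [abelian : Abelian carrier]
  [linear : Linear k carrier]
  [grothendieck : IsGrothendieckAbelian.{u} carrier]

attribute [instance] GrtFlat.category GrtFlat.abelian GrtFlat.linear GrtFlat.grothendieck

variable {k}

/-- A `k`-linear flat morphism `f : A ⟶ B`: an adjunction `f^* ⊣ f_*` of `k`-linear functors, with
`f^* : B ⥤ A` exact. As a left adjoint, `f^*` is right exact, so that left exactness is what has to
be required. -/
structure FlatMorphism (A B : GrtFlat.{u} k) where
  upperStar : LinFunctor k B.carrier A.carrier
  lowerStar : LinFunctor k A.carrier B.carrier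
  adj : upperStar.obj ⊣ lowerStar.obj
  exact : PreservesFiniteLimits upperStar.obj

namespace FlatMorphism

/-- A 2-cell `f ⟶ g` between flat morphisms is a natural transformation `f^* ⟶ g^*` between
the left adjoints. -/
@[ext]
structure Hom {A B : GrtFlat.{u} k} (f g : FlatMorphism A B) where
  hom : f.upperStar ⟶ g.upperStar

instance {A B : GrtFlat.{u} k} : Category (FlatMorphism A B) where
  Hom f g := Hom f g
  id f := ⟨𝟙 f.upperStar⟩
  comp η θ := ⟨η.hom ≫ θ.hom⟩

section
variable {A B C D : GrtFlat.{u} k}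

lemma hom_ext {f g : FlatMorphism A B} {η θ : f ⟶ g}
    (h : ∀ X, η.hom.hom.app X = θ.hom.hom.app X) : η = θ :=
  Hom.ext (LinFunctor.hom_ext h)

/-- A 2-cell is the same thing as a natural transformation between left adjoints. -/
def homEquiv (f g : FlatMorphism A B) : (f ⟶ g) ≃ (f.upperStar ⟶ g.upperStar) where
  toFun η := η.hom
  invFun η := ⟨η⟩

instance : Preadditive (FlatMorphism A B) where
  homGroup f g := (homEquiv f g).addCommGroup
  add_comp _ _ _ _ _ _ := Hom.ext (Preadditive.add_comp _ _ _ _ _ _)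
  comp_add _ _ _ _ _ _ := Hom.ext (Preadditive.comp_add _ _ _ _ _ _)

instance : Linear k (FlatMorphism A B) where
  homModule f g := (homEquiv f g).module k
  smul_comp _ _ _ _ _ _ := Hom.ext (Linear.smul_comp _ _ _ _ _ _)
  comp_smul _ _ _ _ _ _ := Hom.ext (Linear.comp_smul _ _ _ _ _ _)

/-- An invertible 2-cell from an isomorphism between left adjoints. -/
def isoMk {f g : FlatMorphism A B} (e : f.upperStar ≅ g.upperStar) : f ≅ g where
  hom := ⟨e.hom⟩
  inv := ⟨e.inv⟩
  hom_inv_id := Hom.ext e.hom_inv_id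
  inv_hom_id := Hom.ext e.inv_hom_id

/-- The identity flat morphism. -/
def id (A : GrtFlat.{u} k) : FlatMorphism A A where
  upperStar := LinFunctor.id k A.carrier
  lowerStar := LinFunctor.id k A.carrier
  adj := Adjunction.id
  exact := inferInstance

/-- The composite of flat morphisms, with `(f ≫ g)^* = f^* g^*` and `(f ≫ g)_* = g_* f_*`. -/
def comp (f : FlatMorphism A B) (g : FlatMorphism B C) : FlatMorphism A C where
  upperStar := g.upperStar.comp f.upperStar
  lowerStar := f.lowerStar.comp g.lowerStar
  adj := g.adj.comp f.adj
  exact :=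
    haveI := f.exact
    haveI := g.exact
    comp_preservesFiniteLimits g.upperStar.obj f.upperStar.obj

/-- Left whiskering. -/
def whiskerLeft (f : FlatMorphism A B) {g h : FlatMorphism B C} (η : g ⟶ h) :
    f.comp g ⟶ f.comp h :=
  ⟨LinFunctor.whiskerRight η.hom f.upperStar⟩

/-- Right whiskering. -/
def whiskerRight {f g : FlatMorphism A B} (η : f ⟶ g) (h : FlatMorphism B C) :
    f.comp h ⟶ g.comp h :=
  ⟨LinFunctor.whiskerLeft h.upperStar η.hom⟩

/-- The associator. -/
def associator (f : FlatMorphism A B) (g : FlatMorphism B C) (h : FlatMorphism C D) :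
    (f.comp g).comp h ≅ f.comp (g.comp h) :=
  isoMk (LinFunctor.assoc h.upperStar g.upperStar f.upperStar).symm

/-- The left unitor. -/
def leftUnitor (f : FlatMorphism A B) : (FlatMorphism.id A).comp f ≅ f :=
  isoMk f.upperStar.rightUnitor

/-- The right unitor. -/
def rightUnitor (f : FlatMorphism A B) : f.comp (FlatMorphism.id B) ≅ f :=
  isoMk f.upperStar.leftUnitor

end

end FlatMorphism

/-- The 2-category `Grt_flat` of `k`-linear Grothendieck categories. -/
instance : Bicategory (GrtFlat.{u} k) where
  Hom A B := FlatMorphism A B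
  id A := FlatMorphism.id A
  comp f g := f.comp g
  homCategory A B := inferInstanceAs (Category (FlatMorphism A B))
  whiskerLeft f _ _ η := f.whiskerLeft η
  whiskerRight η h := FlatMorphism.whiskerRight η h
  associator f g h := f.associator g h
  leftUnitor f := f.leftUnitor
  rightUnitor f := f.rightUnitor
  whiskerLeft_id f _ := FlatMorphism.hom_ext fun _ => f.upperStar.obj.map_id _
  whiskerLeft_comp f _ _ _ _ _ := FlatMorphism.hom_ext fun _ => f.upperStar.obj.map_comp _ _
  id_whiskerLeft _ := FlatMorphism.hom_ext fun _ => (id_comp_id _).symm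
  comp_whiskerLeft _ _ _ _ _ := FlatMorphism.hom_ext fun _ => (id_comp_id _).symm
  id_whiskerRight _ _ := FlatMorphism.hom_ext fun _ => rfl
  comp_whiskerRight _ _ _ := FlatMorphism.hom_ext fun _ => rfl
  whiskerRight_id _ := FlatMorphism.hom_ext fun _ => (id_comp_id _).symm
  whiskerRight_comp _ _ _ := FlatMorphism.hom_ext fun _ => (id_comp_id _).symm
  whisker_assoc _ _ _ _ _ := FlatMorphism.hom_ext fun _ => (id_comp_id _).symm
  whisker_exchange η θ := FlatMorphism.hom_ext fun X => η.hom.hom.naturality (θ.hom.hom.app X)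
  pentagon f _ _ _ := FlatMorphism.hom_ext fun _ =>
    (Category.id_comp _).trans ((Category.id_comp _).trans
      ((f.upperStar.obj.map_id _).trans (Category.id_comp _).symm))
  triangle f _ := FlatMorphism.hom_ext fun _ => (Category.id_comp _).trans (f.upperStar.obj.map_id _)

section ULiftHom
variable {A : Type u₁} {B : Type u₂} {C : Type u₃} [Category.{v₁} A] [Category.{v₂} B]
  [Category.{v₃} C] [Preadditive A] [Preadditive B] [Preadditive C]
  [Linear k A] [Linear k B] [Linear k C]

instance : Preadditive (ULiftHom.{w} A) where
  homGroup X Y := inferInstanceAs (AddCommGroup (ULift.{w} (X.objDown ⟶ Y.objDown)))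
  add_comp _ _ _ f f' g := ULift.ext _ _ (Preadditive.add_comp _ _ _ f.down f'.down g.down)
  comp_add _ _ _ f g g' := ULift.ext _ _ (Preadditive.comp_add _ _ _ f.down g.down g'.down)

instance : Linear k (ULiftHom.{w} A) where
  homModule X Y := inferInstanceAs (Module k (ULift.{w} (X.objDown ⟶ Y.objDown)))
  smul_comp _ _ _ r f g := ULift.ext _ _ (Linear.smul_comp _ _ _ r f.down g.down)
  comp_smul _ _ _ f r g := ULift.ext _ _ (Linear.comp_smul _ _ _ f.down r g.down)

namespace LinFunctor

/-- The functor which `F` induces between the categories with lifted morphism sets. -/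
def uliftHom (F : LinFunctor k A B) : LinFunctor k (ULiftHom.{w} A) (ULiftHom.{w} B) where
  obj := ULiftHom.down ⋙ F.obj ⋙ ULiftHom.up
  property := ⟨⟨fun {_ _ f g} => ULift.ext _ _ (F.obj.map_add (f := f.down) (g := g.down))⟩,
    ⟨fun f r => ULift.ext _ _ (F.obj.map_smul r f.down)⟩⟩

/-- The transformation which `η` induces between the lifted functors. -/
def uliftHomMap {F G : LinFunctor k A B} (η : F ⟶ G) :
    (F.uliftHom : LinFunctor k (ULiftHom.{w} A) (ULiftHom.{w} B)) ⟶ G.uliftHom :=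
  ObjectProperty.homMk (Functor.whiskerLeft ULiftHom.down
    (Functor.whiskerRight η.hom ULiftHom.up))

/-- Lifting is compatible with identities. -/
def uliftHomId (A : Type u₁) [Category.{v₁} A] [Preadditive A] [Linear k A] :
    ((LinFunctor.id k A).uliftHom : LinFunctor k (ULiftHom.{w} A) (ULiftHom.{w} A)) ≅
      LinFunctor.id k (ULiftHom.{w} A) :=
  ObjectProperty.isoMk _ (NatIso.ofComponents (fun _ => Iso.refl _) fun _ =>
    (Category.comp_id _).trans (Category.id_comp _).symm)

/-- Lifting is compatible with composition. -/
def uliftHomComp (F : LinFunctor k A B) (G : LinFunctor k B C) :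
    ((F.comp G).uliftHom : LinFunctor k (ULiftHom.{w} A) (ULiftHom.{w} C)) ≅
      (F.uliftHom : LinFunctor k (ULiftHom.{w} A) (ULiftHom.{w} B)).comp G.uliftHom :=
  ObjectProperty.isoMk _ (NatIso.ofComponents (fun _ => Iso.refl _) fun _ =>
    (Category.comp_id _).trans (Category.id_comp _).symm)

end LinFunctor

end ULiftHom

/-- The forgetful 2-functor `U : Grt_flatᵒᵖ → Cat_k` with `U(A) = A`, `U(f) = f^*`. Here `ᵒᵖ`
reverses the 1-cells only. The morphism sets of `U(A)` are lifted to the next universe because the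
hom-categories of `Grt_flat`, with which `U` is compared, have their morphism sets there. -/
def GrtFlat.forget (k : Type u) [CommRing k] :
    (GrtFlat.{u} k)ᵒᵖ ⥤ᵖ LinCat.{u + 1, u + 1, u} k where
  obj A := { carrier := ULiftHom.{u + 1} A.unop.carrier }
  map f := f.unop.upperStar.uliftHom
  map₂ η := LinFunctor.uliftHomMap η.unop2.hom
  map₂_id _ := LinFunctor.hom_ext fun _ => rfl
  map₂_comp _ _ := LinFunctor.hom_ext fun _ => rfl
  mapId A := LinFunctor.uliftHomId A.unop.carrier
  mapComp f g := LinFunctor.uliftHomComp f.unop.upperStar g.unop.upperStar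
  map₂_whisker_left _ _ _ _ := LinFunctor.hom_ext fun _ => (id_comp_id _).symm
  map₂_whisker_right _ _ := LinFunctor.hom_ext fun _ => (id_comp_id _).symm
  map₂_associator _ _ h := LinFunctor.hom_ext fun _ =>
    (id_comp_five (h.unop.upperStar.uliftHom.obj.map_id _)).symm
  map₂_left_unitor f := LinFunctor.hom_ext fun _ =>
    (id_comp_three (f.unop.upperStar.uliftHom.obj.map_id _)).symm
  map₂_right_unitor f := LinFunctor.hom_ext fun X =>
    (id_comp_three (X := f.unop.upperStar.uliftHom.obj.obj X) rfl).symm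

/-- Precomposition with `f`, as a `k`-linear functor `Grt_flat(B, M) ⥤ Grt_flat(A, M)`. -/
def FlatMorphism.precomp {A B : GrtFlat.{u} k} (f : FlatMorphism A B) (M : GrtFlat.{u} k) :
    LinFunctor k (FlatMorphism B M) (FlatMorphism A M) where
  obj :=
    { obj := fun g => f.comp g
      map := fun η => f.whiskerLeft η
      map_id := fun _ => FlatMorphism.hom_ext fun _ => f.upperStar.obj.map_id _
      map_comp := fun _ _ => FlatMorphism.hom_ext fun _ => f.upperStar.obj.map_comp _ _ }
  property := ⟨⟨FlatMorphism.hom_ext fun _ => f.upperStar.obj.map_add⟩,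
    ⟨fun _ _ => FlatMorphism.hom_ext fun _ => f.upperStar.obj.map_smul _ _⟩⟩

/-- The transformation which a 2-cell induces between precomposition functors. -/
def FlatMorphism.precompMap {A B : GrtFlat.{u} k} {f g : FlatMorphism A B} (η : f ⟶ g)
    (M : GrtFlat.{u} k) : f.precomp M ⟶ g.precomp M :=
  ObjectProperty.homMk
    { app := fun h => FlatMorphism.whiskerRight η h
      naturality := fun _ _ θ => FlatMorphism.hom_ext fun X =>
        η.hom.hom.naturality (θ.hom.hom.app X) }

/-- Precomposition with an identity. -/
def FlatMorphism.precompId (A M : GrtFlat.{u} k) :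
    (FlatMorphism.id A).precomp M ≅ LinFunctor.id k (FlatMorphism A M) :=
  ObjectProperty.isoMk _ (NatIso.ofComponents (fun f => f.leftUnitor) fun _ =>
    FlatMorphism.hom_ext fun _ => (Category.comp_id _).trans (Category.id_comp _).symm)

/-- Precomposition with a composite. -/
def FlatMorphism.precompComp {A B C : GrtFlat.{u} k} (f : FlatMorphism A B)
    (g : FlatMorphism B C) (M : GrtFlat.{u} k) :
    (f.comp g).precomp M ≅ (g.precomp M).comp (f.precomp M) :=
  ObjectProperty.isoMk _ (NatIso.ofComponents (fun h => f.associator g h) fun _ =>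
    FlatMorphism.hom_ext fun _ => (Category.comp_id _).trans (Category.id_comp _).symm)

/-- The representable 2-functor `Grt_flat(-, M) : Grt_flatᵒᵖ → Cat_k`. -/
def GrtFlat.homTo (M : GrtFlat.{u} k) : (GrtFlat.{u} k)ᵒᵖ ⥤ᵖ LinCat.{u + 1, u + 1, u} k where
  obj A := { carrier := FlatMorphism A.unop M }
  map f := FlatMorphism.precomp f.unop M
  map₂ η := FlatMorphism.precompMap η.unop2 M
  map₂_id _ := LinFunctor.hom_ext fun _ => rfl
  map₂_comp _ _ := LinFunctor.hom_ext fun _ => rfl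
  mapId A := FlatMorphism.precompId A.unop M
  mapComp f g := FlatMorphism.precompComp g.unop f.unop M
  map₂_whisker_left _ _ _ _ := LinFunctor.hom_ext fun _ =>
    FlatMorphism.hom_ext fun _ => (id_comp_id _).symm
  map₂_whisker_right _ _ := LinFunctor.hom_ext fun _ =>
    FlatMorphism.hom_ext fun _ => (id_comp_id _).symm
  map₂_associator _ _ h := LinFunctor.hom_ext fun _ =>
    FlatMorphism.hom_ext fun _ => (id_comp_five (h.unop.upperStar.obj.map_id _)).symm
  map₂_left_unitor f := LinFunctor.hom_ext fun _ =>
    FlatMorphism.hom_ext fun _ => (id_comp_three (f.unop.upperStar.obj.map_id _)).symm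
  map₂_right_unitor _ := LinFunctor.hom_ext fun _ =>
    FlatMorphism.hom_ext fun _ => (id_comp_three rfl).symm

/-- The Grothendieck category `Mod(k)[𝕆] = Mod(fpmod(k)ᵒᵖ)`. -/
noncomputable def objectClassifier (k : Type u) [CommRing k] : GrtFlat.{u} k where
  carrier := Modules k (FpMod k)ᵒᵖ

end Cat
end LinearCat

/-! The generic object `genericObj k` is the module represented by `k`; under the identification of
morphisms `k ⟶ M` with elements of `M` it is the forgetful functor on `fpmod(k)`. Evaluation `f ↦
f^*(genericObj k)` is the desired equivalence.

The link is the cotensor `Hom(N, X)` of an object `X` by a finitely presented module `N`. A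
presentation of `N` displays it as the kernel of a matrix between finite powers of `X`, so every
left exact linear functor preserves it (`IsCotensor.map`). The module represented by `N` is the
cotensor of the generic object by `N` (`isCotensorFunctor_yoneda`). Hence the restriction of an
exact `f^*` to representables is `N ↦ Hom(N, X)` with `X = f^*(genericObj k)`, and since
representables are dense, 2-cells are the same as morphisms between the values at the generic object
(`natTrans_ext_of_generic`, `exists_natTrans_of_generic`).

Conversely, given `X`, put `G(N) = Hom(N, X)` and let `T` be the left adjoint of the nerve of `G`,
so that `T` extends `G`. The main point is that `T` is exact
(`preservesFiniteLimits_of_isCotensorFunctor`). An injectivity argument reduces this to inclusions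
of subobjects of a separator; such a subobject is the filtered union of its submodules with one
generator, and for those a morphism killed by `T` of the inclusion is killed because `G` turns
cokernels in `fpmod(k)` into kernels.

Thus evaluation is fully faithful and essentially surjective for each Grothendieck category.
Choosing classifying morphisms gives a pseudonatural inverse, whose coherence laws need only be
checked at the generic object. -/

namespace LinearCat

/-! ### Cotensors of objects by modules -/

section Cotensor

variable {k : Type u} [CommRing k] {C : Type u₁} [Category.{v₁} C] [Preadditive C] [Linear k C]

/-- The object `P` with the linear family `ev` of morphisms `P ⟶ X` is a cotensor of `X` by the
module `M`: morphisms `Z ⟶ P` correspond to linear maps `M →ₗ[k] (Z ⟶ X)`. -/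
structure IsCotensor {M : Type*} [AddCommGroup M] [Module k M] {X P : C}
    (ev : M →ₗ[k] (P ⟶ X)) : Prop where
  hom_ext {Z : C} (s t : Z ⟶ P) (h : ∀ m, s ≫ ev m = t ≫ ev m) : s = t
  exists_lift {Z : C} (φ : M →ₗ[k] (Z ⟶ X)) : ∃ s : Z ⟶ P, ∀ m, s ≫ ev m = φ m

namespace IsCotensor

variable {M : Type*} [AddCommGroup M] [Module k M] {X P : C} {ev : M →ₗ[k] (P ⟶ X)}

/-- The morphism to a cotensor which a linear family of morphisms determines. -/
noncomputable def lift (h : IsCotensor ev) {Z : C} (φ : M →ₗ[k] (Z ⟶ X)) : Z ⟶ P :=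
  (h.exists_lift φ).choose

@[simp]
lemma lift_ev (h : IsCotensor ev) {Z : C} (φ : M →ₗ[k] (Z ⟶ X)) (m : M) :
    h.lift φ ≫ ev m = φ m :=
  (h.exists_lift φ).choose_spec m

end IsCotensor

/-- Cotensors exist in a complete abelian category. -/
lemma exists_isCotensor [HasLimitsOfSize.{u, u} C] (M : Type u) [AddCommGroup M]
    [Module k M] (X : C) : ∃ (P : C) (ev : M →ₗ[k] (P ⟶ X)), IsCotensor ev := by
  let A : C := ∏ᶜ fun _ : M => X
  let p (m : M) : A ⟶ X := Pi.π (fun _ : M => X) m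
  let B : C := ∏ᶜ fun _ : M × M => X
  let D : C := ∏ᶜ fun _ : k × M => X
  -- `f` and `g` measure the failure of the family of projections `p m` to be additive and
  -- homogeneous in `m`; on their common kernel the family is linear, universally so.
  let f : A ⟶ B := Pi.lift fun q => p (q.1 + q.2) - (p q.1 + p q.2)
  let g : A ⟶ D := Pi.lift fun q => p (q.1 • q.2) -
    q.1 • p q.2
  let j := kernel.ι (prod.lift f g)
  have hj : j ≫ prod.lift f g = 0 := kernel.condition _
  have hf : j ≫ f = 0 := by
    have := hj =≫ prod.fst
    rwa [Category.assoc, prod.lift_fst, zero_comp] at this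
  have hg : j ≫ g = 0 := by
    have := hj =≫ prod.snd
    rwa [Category.assoc, prod.lift_snd, zero_comp] at this
  have hadd (m n : M) : j ≫ p (m + n) = j ≫ p m + j ≫ p n := by
    have := hf =≫ Pi.π _ (m, n)
    rw [Category.assoc, Pi.lift_π, Preadditive.comp_sub, zero_comp, sub_eq_zero] at this
    simpa using this
  have hsmul (r : k) (m : M) : j ≫ p (r • m) = r • (j ≫ p m) := by
    have := hg =≫ Pi.π _ (r, m)
    rw [Category.assoc, Pi.lift_π, Preadditive.comp_sub, zero_comp, sub_eq_zero] at this
    simpa using this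
  refine ⟨kernel (prod.lift f g), { toFun := fun m => j ≫ p m, map_add' := hadd, map_smul' := hsmul },
    ⟨fun s t h => ?_, fun {Z} φ => ?_⟩⟩
  · rw [← cancel_mono j]
    refine Pi.hom_ext _ _ fun m => ?_
    simpa using h m
  · have hp (m : M) : Pi.lift (fun m => φ m) ≫ p m = φ m := Pi.lift_π _ _
    refine ⟨kernel.lift _ (Pi.lift fun m => φ m) (prod.hom_ext ?_ ?_), fun m => ?_⟩
    · rw [Category.assoc, prod.lift_fst, zero_comp]
      refine Pi.hom_ext _ _ fun q => ?_
      rw [Category.assoc, Pi.lift_π, Preadditive.comp_sub, Preadditive.comp_add, hp, hp, hp,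
        map_add, sub_self, zero_comp]
    · rw [Category.assoc, prod.lift_snd, zero_comp]
      refine Pi.hom_ext _ _ fun q => ?_
      rw [Category.assoc, Pi.lift_π, Preadditive.comp_sub, Linear.comp_smul, hp, hp,
        map_smul, sub_self, zero_comp]
    · change kernel.lift _ _ _ ≫ j ≫ p m = φ m
      rw [kernel.lift_ι_assoc, hp]

/-- A left exact functor preserves cotensors by finitely presented modules. -/
lemma IsCotensor.map {D : Type u₂} [Category.{v₂} D] [Preadditive D] [Linear k D]
    [HasFiniteBiproducts C] {M : Type*} [AddCommGroup M] [Module k M]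
    [Module.FinitePresentation k M] {X P : C} {ev : M →ₗ[k] (P ⟶ X)} (h : IsCotensor ev)
    (T : C ⥤ D) [T.Additive] [T.Linear k] [PreservesFiniteLimits T] :
    IsCotensor (T.mapLinearMap k ∘ₗ ev) := by
  obtain ⟨n, K, e, hK⟩ := Module.FinitePresentation.exists_fin k M
  obtain ⟨m, r, rfl⟩ := Submodule.fg_iff_exists_fin_generating_family.1 hK
  let q : (Fin n → k) →ₗ[k] M := e.symm.toLinearMap ∘ₗ Submodule.mkQ _
  have hq : Function.Surjective q := e.symm.surjective.comp (Submodule.mkQ_surjective _)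
  have hker (x : Fin n → k) : q x = 0 ↔ x ∈ Submodule.span k (Set.range r) := by
    simp [q]
  have hqs (x : Fin n → k) : q x = ∑ i, x i • q (Pi.single i 1) := by
    conv_lhs => rw [pi_eq_sum_univ' x]
    simp only [map_sum, map_smul]
  have hrel (j : Fin m) : ∑ i, r j i • q (Pi.single i 1) = 0 := by
    rw [← hqs]
    exact (hker _).2 (Submodule.subset_span ⟨j, rfl⟩)
  -- With `m` relations among `n` generators of `M`, the relation matrix induces `d : Xⁿ ⟶ Xᵐ`. The
  -- proof identifies `P` with the kernel of `d`, a finite limit, which `T` preserves.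
  let E : C := ⨁ fun _ : Fin n => X
  let F : C := ⨁ fun _ : Fin m => X
  let d : E ⟶ F := biproduct.matrix fun i j => r j i • 𝟙 X
  let a : P ⟶ E := biproduct.lift fun i => ev (q (Pi.single i 1))
  have had : a ≫ d = 0 := by
    refine biproduct.hom_ext _ _ fun j => ?_
    simp only [a, d, Category.assoc, biproduct.matrix_π, zero_comp, biproduct.lift_desc,
      Linear.comp_smul, Category.comp_id]
    rw [← map_zero ev, ← hrel j, map_sum]
    simp only [map_smul]
  have hextend {Z : C} (s t : Z ⟶ P)
      (hst : ∀ i, s ≫ ev (q (Pi.single i 1)) = t ≫ ev (q (Pi.single i 1))) : s = t := by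
    refine h.hom_ext _ _ fun x => ?_
    obtain ⟨x, rfl⟩ := hq x
    rw [hqs]
    simp [hst, Preadditive.comp_sum]
  have descend {V : Type _} [AddCommGroup V] [Module k V] (z : Fin n → V)
      (hz : ∀ j, ∑ i, r j i • z i = 0) : ∃ φ : M →ₗ[k] V, ∀ i, φ (q (Pi.single i 1)) = z i := by
    refine ⟨Submodule.liftQ _ (Fintype.linearCombination k z) (Submodule.span_le.2 ?_) ∘ₗ
      e.toLinearMap, fun i => ?_⟩
    · rintro _ ⟨j, rfl⟩
      simpa [Fintype.linearCombination_apply] using hz j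
    · simp [q, Fintype.linearCombination_apply_single]
  have hπ (i : Fin n) : a ≫ biproduct.π _ i = ev (q (Pi.single i 1)) := biproduct.lift_π _ _
  have hd (i : Fin n) (j : Fin m) : biproduct.ι (fun _ : Fin n => X) i ≫ d ≫ biproduct.π _ j =
      r j i • 𝟙 X := by
    simp [d]
  have : Mono a := Preadditive.mono_of_cancel_zero _ fun s hs => hextend _ _ fun i => by
    rw [← hπ, reassoc_of% hs, zero_comp, zero_comp]
  have hlim : IsLimit (KernelFork.ofι a had) := by
    have key {Z : C} (s : Z ⟶ E) (hs : s ≫ d = 0) : ∃ t : Z ⟶ P, t ≫ a = s := by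
      obtain ⟨φ, hφ⟩ := descend (fun i => s ≫ biproduct.π _ i) fun j => by
        have := hs =≫ biproduct.π _ j
        simpa [d, biproduct.matrix_π, biproduct.desc_eq, Preadditive.comp_sum] using this
      refine ⟨h.lift φ, biproduct.hom_ext _ _ fun i => ?_⟩
      rw [Category.assoc, hπ, h.lift_ev, hφ]
    exact KernelFork.IsLimit.ofι' _ _ fun s hs => ⟨(key s hs).choose, (key s hs).choose_spec⟩
  have hlimT := KernelFork.mapIsLimit _ hlim T
  refine ⟨fun {Z} s t hst => ?_, fun {Z} φ => ?_⟩
  · have htot : 𝟙 (T.obj E) = ∑ i : Fin n, T.map (biproduct.π _ i) ≫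
        T.map (biproduct.ι (fun _ => X) i) := by
      simp only [← T.map_comp, ← T.map_sum, biproduct.total, E, T.map_id]
    rw [← cancel_mono (T.map a), ← Category.comp_id (s ≫ _), ← Category.comp_id (t ≫ _), htot,
      Preadditive.comp_sum, Preadditive.comp_sum]
    refine Finset.sum_congr rfl fun i _ => ?_
    have := hst (q (Pi.single i 1))
    change s ≫ T.map (ev _) = t ≫ T.map (ev _) at this
    rw [← hπ, T.map_comp] at this
    simp only [Category.assoc] at this ⊢
    rw [reassoc_of% this]
  · let z : Z ⟶ T.obj E := ∑ i, φ (q (Pi.single i 1)) ≫ T.map (biproduct.ι (fun _ => X) i)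
    have hzπ (i : Fin n) : z ≫ T.map (biproduct.π _ i) = φ (q (Pi.single i 1)) := by
      simp only [z, Preadditive.sum_comp, Category.assoc, ← T.map_comp, biproduct.ι_π]
      rw [Finset.sum_eq_single i (fun j _ hj => by simp [hj]) (by simp)]
      simp
    have hzd : z ≫ T.map d = 0 := by
      have htot : 𝟙 (T.obj F) = ∑ i : Fin m, T.map (biproduct.π _ i) ≫
          T.map (biproduct.ι (fun _ => X) i) := by
        simp only [← T.map_comp, ← T.map_sum, biproduct.total, F, T.map_id]
      rw [← Category.comp_id (z ≫ _), htot, Preadditive.comp_sum]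
      refine Finset.sum_eq_zero fun j _ => ?_
      have : z ≫ T.map d ≫ T.map (biproduct.π _ j) = 0 := by
        simp only [z, Preadditive.sum_comp, Category.assoc, ← T.map_comp, hd, T.map_smul,
          T.map_id, Linear.comp_smul, Category.comp_id]
        rw [← map_zero φ, ← hrel j, map_sum]
        simp only [map_smul]
      simp only [Category.assoc, reassoc_of% this, zero_comp]
    obtain ⟨s, hs⟩ : ∃ s : Z ⟶ T.obj P, s ≫ T.map a = z :=
      ⟨_, (KernelFork.IsLimit.lift' hlimT z hzd).2⟩
    refine ⟨s, fun x => ?_⟩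
    obtain ⟨x, rfl⟩ := hq x
    have key (i : Fin n) : s ≫ T.map (ev (q (Pi.single i 1))) = φ (q (Pi.single i 1)) := by
      rw [← hπ, T.map_comp, reassoc_of% hs, hzπ]
    change s ≫ T.map (ev (q x)) = _
    rw [hqs]
    simp only [map_sum, map_smul, T.map_sum, T.map_smul, Preadditive.comp_sum, Linear.comp_smul, key]

end Cotensor

/-! ### Finitely presented modules: quotients, sums, and elements as morphisms -/

section FpMod

variable {k : Type u} [CommRing k]

namespace FpMod

lemma exists_iso (M : ModuleCat.{u} k) [Module.FinitePresentation k M] :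
    ∃ N : FpMod k, Nonempty (FinPres.module k N ≅ M) := by
  obtain ⟨n, K, e, hK⟩ := Module.FinitePresentation.exists_fin k M
  exact ⟨(⟨n, K, hK⟩ : FinPres k), ⟨LinearEquiv.toModuleIso e.symm⟩⟩

/-- The quotient of a finitely presented module by a finitely generated submodule is finitely
presented. -/
lemma exists_quotient (N : FpMod k) (W : Submodule k (FinPres.module k N)) (hW : W.FG) :
    ∃ (C : FpMod k) (q : N ⟶ C), Function.Surjective q.hom.hom ∧ LinearMap.ker q.hom.hom = W := by
  have : Module.FinitePresentation k (FinPres.module k N) := FinPres.finitePresentation k N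
  have : Module.FinitePresentation k (FinPres.module k N ⧸ W) :=
    Module.finitePresentation_of_surjective W.mkQ W.mkQ_surjective (by rwa [Submodule.ker_mkQ])
  obtain ⟨C, ⟨e⟩⟩ := exists_iso (ModuleCat.of k (FinPres.module k N ⧸ W))
  refine ⟨C, InducedCategory.homMk (ModuleCat.ofHom W.mkQ ≫ e.inv), ?_, ?_⟩
  · exact e.symm.toLinearEquiv.surjective.comp W.mkQ_surjective
  · change LinearMap.ker (e.symm.toLinearEquiv.toLinearMap ∘ₗ W.mkQ) = W
    rw [LinearEquiv.ker_comp, Submodule.ker_mkQ]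

/-- The category of finitely presented modules has binary direct sums. -/
lemma exists_sum (M N : FpMod k) : ∃ (P : FpMod k) (i : M ⟶ P) (j : N ⟶ P) (p : P ⟶ M) (q : P ⟶ N),
    i ≫ p = 𝟙 M ∧ j ≫ q = 𝟙 N ∧ i ≫ q = 0 ∧ j ≫ p = 0 := by
  have : Module.FinitePresentation k (FinPres.module k M) := FinPres.finitePresentation k M
  have : Module.FinitePresentation k (FinPres.module k N) := FinPres.finitePresentation k N
  obtain ⟨P, ⟨e⟩⟩ := exists_iso (ModuleCat.of k (FinPres.module k M × FinPres.module k N))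
  have key {V W : ModuleCat.{u} k} (a : V ⟶ _) (b : _ ⟶ W) :
      (a ≫ e.inv) ≫ e.hom ≫ b = a ≫ b := by simp
  refine ⟨P, InducedCategory.homMk (ModuleCat.ofHom (LinearMap.inl k (FinPres.module k M) (FinPres.module k N)) ≫ e.inv),
    InducedCategory.homMk (ModuleCat.ofHom (LinearMap.inr k (FinPres.module k M) (FinPres.module k N)) ≫ e.inv),
    InducedCategory.homMk (e.hom ≫ ModuleCat.ofHom (LinearMap.fst k (FinPres.module k M) (FinPres.module k N))),
    InducedCategory.homMk (e.hom ≫ ModuleCat.ofHom (LinearMap.snd k (FinPres.module k M) (FinPres.module k N))), ?_, ?_, ?_, ?_⟩ <;>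
  · apply InducedCategory.hom_ext
    refine (key _ _).trans ?_
    ext x
    rfl

variable (k) in
/-- The free module of rank one. -/
noncomputable def unit : FpMod k := (exists_iso (ModuleCat.of k k)).choose

variable (k) in
/-- The coordinate on the free module of rank one. -/
noncomputable def unitEquiv : FinPres.module k (unit k) ≃ₗ[k] k :=
  (exists_iso (ModuleCat.of k k)).choose_spec.some.toLinearEquiv

/-- The generator of the free module of rank one. -/
noncomputable def one : FinPres.module k (unit k) := (unitEquiv k).symm 1

lemma eq_smul_one (x : FinPres.module k (unit k)) : x = unitEquiv k x • one := by
  apply (unitEquiv k).injective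
  simp [one]

/-- The morphism out of the free module of rank one which an element determines. -/
noncomputable def elem (N : FpMod k) : FinPres.module k N →ₗ[k] (unit k ⟶ N) where
  toFun m := InducedCategory.homMk
    (ModuleCat.ofHom ((LinearMap.toSpanSingleton k _ m) ∘ₗ (unitEquiv k).toLinearMap))
  map_add' m n := by
    ext x
    exact smul_add (unitEquiv k x) m n
  map_smul' r m := by
    ext x
    exact smul_comm (unitEquiv k x) r m

lemma elem_one {N : FpMod k} (m : FinPres.module k N) : (elem N m).hom.hom one = m := by
  change unitEquiv k one • m = m
  simp [one]

lemma elem_hom {N : FpMod k} (f : unit k ⟶ N) : elem N (f.hom.hom one) = f := by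
  ext x
  change unitEquiv k x • f.hom.hom one = f.hom.hom x
  conv_rhs => rw [eq_smul_one x, map_smul]

lemma elem_comp {M N : FpMod k} (m : FinPres.module k M) (f : M ⟶ N) :
    elem M m ≫ f = elem N (f.hom.hom m) := by
  ext x
  exact f.hom.hom.map_smul (unitEquiv k x) m

end FpMod

end FpMod

/-! ### The Yoneda embedding and nerve functors -/

section Nerve

variable {k : Type u} [CommRing k] {𝔞 : Type u} [Category.{u} 𝔞] [Preadditive 𝔞] [Linear k 𝔞]

variable (k) in
/-- The morphism between representable modules which a morphism of `𝔞` induces. -/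
def yonedaMap {X Y : 𝔞} (f : X ⟶ Y) : yonedaObj k 𝔞 X ⟶ yonedaObj k 𝔞 Y :=
  ObjectProperty.homMk ((linearYoneda k 𝔞).map f)

lemma yonedaMap_comp {X Y Z : 𝔞} (f : X ⟶ Y) (g : Y ⟶ Z) :
    yonedaMap k (f ≫ g) = yonedaMap k f ≫ yonedaMap k g := by
  ext1
  exact (linearYoneda k 𝔞).map_comp f g

variable (k 𝔞) in
/-- The Yoneda embedding into the category of modules. -/
def yonedaFunctor : 𝔞 ⥤ Modules k 𝔞 where
  obj X := yonedaObj k 𝔞 X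
  map f := yonedaMap k f
  map_id X := by ext1; exact (linearYoneda k 𝔞).map_id X
  map_comp f g := yonedaMap_comp f g

instance : (yonedaFunctor k 𝔞).Additive where
  map_add {X Y f g} := by
    ext Z t
    exact Preadditive.comp_add _ _ _ t f g

instance : (yonedaFunctor k 𝔞).Linear k where
  map_smul {X Y} f r := by
    ext Z t
    exact Linear.comp_smul _ _ _ t r f

lemma yonedaMap_zero (X Y : 𝔞) : yonedaMap k (0 : X ⟶ Y) = 0 :=
  (yonedaFunctor k 𝔞).map_zero X Y

lemma yonedaLift_app (F : Modules k 𝔞) (X : 𝔞) (x : F.obj.obj (op X)) {Y : 𝔞} (t : Y ⟶ X) :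
    (yonedaLift k 𝔞 F X x).hom.app (op Y) t = F.obj.map t.op x := rfl

lemma yonedaLift_app_id (F : Modules k 𝔞) (X : 𝔞) (x : F.obj.obj (op X)) :
    (yonedaLift k 𝔞 F X x).hom.app (op X) (𝟙 X) = x := by
  rw [yonedaLift_app, op_id, F.obj.map_id]
  rfl

lemma yonedaLift_hom {F : Modules k 𝔞} {X : 𝔞} (f : yonedaObj k 𝔞 X ⟶ F) :
    yonedaLift k 𝔞 F X (f.hom.app (op X) (𝟙 X)) = f := by
  ext Y (t : Y.unop ⟶ X)
  have := congr($(f.hom.naturality t.op) (𝟙 X))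
  change f.hom.app Y (t ≫ 𝟙 X) = F.obj.map t.op (f.hom.app (op X) (𝟙 X)) at this
  rw [Category.comp_id] at this
  exact this.symm

lemma yoneda_hom_ext {F : Modules k 𝔞} {X : 𝔞} {f g : yonedaObj k 𝔞 X ⟶ F}
    (h : f.hom.app (op X) (𝟙 X) = g.hom.app (op X) (𝟙 X)) : f = g := by
  rw [← yonedaLift_hom f, ← yonedaLift_hom g, h]

lemma yonedaLift_comp {F G : Modules k 𝔞} {X : 𝔞} (x : F.obj.obj (op X)) (f : F ⟶ G) :
    yonedaLift k 𝔞 F X x ≫ f = yonedaLift k 𝔞 G X (f.hom.app (op X) x) := by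
  apply yoneda_hom_ext
  rw [yonedaLift_app_id]
  change f.hom.app (op X) ((yonedaLift k 𝔞 F X x).hom.app (op X) (𝟙 X)) = _
  rw [yonedaLift_app_id]

lemma map_yonedaLift {F : Modules k 𝔞} {X Y : 𝔞} (x : F.obj.obj (op X)) (t : Y ⟶ X) :
    yonedaMap k t ≫ yonedaLift k 𝔞 F X x =
      yonedaLift k 𝔞 F Y (F.obj.map t.op x) := by
  apply yoneda_hom_ext
  rw [yonedaLift_app_id]
  change F.obj.map (𝟙 Y ≫ t).op x = _
  rw [Category.id_comp]

lemma yonedaLift_add {F : Modules k 𝔞} {X : 𝔞} (x y : F.obj.obj (op X)) :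
    yonedaLift k 𝔞 F X (x + y) = yonedaLift k 𝔞 F X x + yonedaLift k 𝔞 F X y := by
  ext Y (t : Y.unop ⟶ X)
  exact map_add (F.obj.map t.op).hom x y

lemma yonedaLift_smul {F : Modules k 𝔞} {X : 𝔞} (r : k) (x : F.obj.obj (op X)) :
    yonedaLift k 𝔞 F X (r • x) = r • yonedaLift k 𝔞 F X x := by
  ext Y (t : Y.unop ⟶ X)
  exact map_smul (F.obj.map t.op).hom r x

lemma exists_yonedaMap_eq {X Y : 𝔞} (f : yonedaObj k 𝔞 X ⟶ yonedaObj k 𝔞 Y) :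
    ∃ t : X ⟶ Y, yonedaMap k t = f :=
  ⟨f.hom.app (op X) (𝟙 X), yoneda_hom_ext (Category.id_comp (X := X) (Y := Y) _)⟩

/-- Elements of a module are morphisms from representables, so representables jointly detect
equality. -/
lemma modules_hom_ext {F G : Modules k 𝔞} {f g : F ⟶ G}
    (h : ∀ (X : 𝔞) (x : F.obj.obj (op X)),
      yonedaLift k 𝔞 F X x ≫ f = yonedaLift k 𝔞 F X x ≫ g) : f = g := by
  ext X x
  have := congr(($(h X.unop x)).hom.app X (𝟙 X.unop))
  rw [yonedaLift_comp, yonedaLift_comp] at this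
  change (yonedaLift k 𝔞 G X.unop _).hom.app (op X.unop) (𝟙 X.unop) =
    (yonedaLift k 𝔞 G X.unop _).hom.app (op X.unop) (𝟙 X.unop) at this
  rwa [yonedaLift_app_id, yonedaLift_app_id] at this

variable {A : Type u₁} [Category.{u} A] [Preadditive A] [Linear k A]
  (G : 𝔞 ⥤ A) [G.Additive] [G.Linear k]

variable (k) in
/-- The nerve functor `Z ↦ Hom(G(-), Z)` of a `k`-linear functor `G`. -/
def nerve : A ⥤ Modules k 𝔞 where
  obj Z := ⟨G.op ⋙ (linearYoneda k A).obj Z,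
    ⟨fun {X Y f g} => by
      ext (t : G.obj X.unop ⟶ Z)
      change G.map (f.unop + g.unop) ≫ t = G.map f.unop ≫ t + G.map g.unop ≫ t
      rw [G.map_add, Preadditive.add_comp]⟩,
    ⟨fun {X Y} f r => by
      ext (t : G.obj X.unop ⟶ Z)
      change G.map (r • f.unop) ≫ t = r • (G.map f.unop ≫ t)
      rw [G.map_smul, Linear.smul_comp]⟩⟩
  map f := ObjectProperty.homMk (Functor.whiskerLeft G.op ((linearYoneda k A).map f))
  map_id Z := by
    ext1
    exact congr(Functor.whiskerLeft G.op $((linearYoneda k A).map_id Z))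
  map_comp f g := by
    ext1
    exact congr(Functor.whiskerLeft G.op $((linearYoneda k A).map_comp f g))

instance : (nerve k G).Additive where
  map_add {X Y f g} := by
    ext Z t
    exact Preadditive.comp_add _ _ _ t f g

instance : (nerve k G).Linear k where
  map_smul {X Y} f r := by
    ext Z t
    exact Linear.comp_smul _ _ _ t r f

instance (X : A) : PreservesLimits ((linearCoyoneda k A).obj (op X)) :=
  haveI : PreservesLimits ((linearCoyoneda k A).obj (op X) ⋙ forget (ModuleCat.{u} k)) :=
    inferInstanceAs (PreservesLimits (coyoneda.obj (op X)))
  preservesLimits_of_reflects_of_preserves _ (forget (ModuleCat.{u} k))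

/-- Limits of modules are computed objectwise, and at each object the nerve is a corepresentable
functor. This is the continuity that the adjoint functor theorem requires. -/
instance : PreservesLimits (nerve k G) :=
  haveI : PreservesLimits (nerve k G ⋙ (linFunctor k 𝔞ᵒᵖ (ModuleCat.{u} k)).ι) :=
    preservesLimits_of_evaluation _ fun X =>
      inferInstanceAs (PreservesLimits ((linearCoyoneda k A).obj (op (G.obj X.unop))))
  preservesLimits_of_reflects_of_preserves _ (linFunctor k 𝔞ᵒᵖ (ModuleCat.{u} k)).ι

end Nerve

/-! ### Morphisms from a representable to a coproduct of representables -/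

section Detect

variable {k : Type u} [CommRing k] {𝔞 : Type u} [Category.{u} 𝔞] [Preadditive 𝔞] [Linear k 𝔞]

variable (k 𝔞) in
lemma isSeparator_sigma_yonedaObj : IsSeparator (∐ (yonedaObj k 𝔞)) :=
  (isSeparator_sigma _).2 fun _ _ _ _ h => modules_hom_ext fun X x =>
    h _ (ObjectProperty.ofObj_apply _ X) (yonedaLift k 𝔞 _ X x)

open scoped Classical in
/-- A morphism from a representable module to a coproduct of representable modules is detected by
finitely many of its components. -/
lemma exists_finset_detecting {X : 𝔞} (y : yonedaObj k 𝔞 X ⟶ ∐ (yonedaObj k 𝔞)) :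
    ∃ S : Finset 𝔞, ∀ {F : Modules k 𝔞} (t : F ⟶ yonedaObj k 𝔞 X),
      (∀ Y ∈ S, t ≫ y ≫ Sigma.π (yonedaObj k 𝔞) Y = 0) → t ≫ y = 0 := by
  let Φ : Modules k 𝔞 ⥤ Type u := (linFunctor k 𝔞ᵒᵖ (ModuleCat.{u} k)).ι ⋙
    (evaluation _ _).obj (op X) ⋙ forget (ModuleCat.{u} k)
  -- The coproduct is the filtered colimit of its finite subcoproducts, and `Φ` takes this to a
  -- colimit of sets. So the element which corresponds to `y` already lives in a finite
  -- subcoproduct.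
  have hc := isColimitOfPreserves Φ
    (CoproductsFromFiniteFiltered.isColimitFiniteSubproductsCocone (yonedaObj k 𝔞))
  obtain ⟨S, y', hy'⟩ := Types.jointly_surjective_of_isColimit hc (y.hom.app (op X) (𝟙 X))
  let ι (Y : S) := Sigma.ι (fun Y : S => yonedaObj k 𝔞 Y.1.as) Y
  let σ : (∐ fun Y : S => yonedaObj k 𝔞 Y.1.as) ⟶ ∐ (yonedaObj k 𝔞) :=
    Limits.Sigma.desc fun Y => Sigma.ι (yonedaObj k 𝔞) Y.1.as
  obtain ⟨z, hz⟩ : ∃ z, z ≫ σ = y := by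
    refine ⟨yonedaLift k 𝔞 _ X y', ?_⟩
    exact (yonedaLift_comp _ _).trans ((congrArg _ hy').trans (yonedaLift_hom y))
  have hι (Y : S) : ι Y ≫ σ = Sigma.ι (yonedaObj k 𝔞) Y.1.as := Sigma.ι_desc _ _
  have hσ : σ = ∑ Y : S, σ ≫ Sigma.π (yonedaObj k 𝔞) Y.1.as ≫ Sigma.ι (yonedaObj k 𝔞) Y.1.as := by
    refine Limits.Sigma.hom_ext _ _ fun Y => ?_
    change ι Y ≫ σ = ι Y ≫ _
    rw [Preadditive.comp_sum, Finset.sum_eq_single Y]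
    · rw [reassoc_of% hι Y, hι Y, Sigma.ι_π_assoc]
      simp
    · intro Z _ hZ
      rw [reassoc_of% hι Y, Sigma.ι_π_assoc, dif_neg, zero_comp]
      exact fun h => hZ (Subtype.ext (Discrete.ext h.symm))
    · simp
  refine ⟨S.image Discrete.as, fun t ht => ?_⟩
  rw [← hz, hσ, Preadditive.comp_sum, Preadditive.comp_sum]
  refine Finset.sum_eq_zero fun Y _ => ?_
  have := ht Y.1.as (Finset.mem_image_of_mem _ Y.2)
  rw [← hz] at this
  simp only [Category.assoc] at this ⊢
  rw [reassoc_of% this, zero_comp]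

end Detect

/-! ### A criterion for exactness of left adjoints -/

section Exact

variable {C : Type u₁} [Category.{v₁} C] [Abelian C] {D : Type u₂} [Category.{v₂} D]
  {T : C ⥤ D} {R : D ⥤ C}

/-- A left adjoint functor preserves monomorphisms if it preserves the inclusions of the subobjects
of a separator. -/
lemma preservesMonomorphisms_of_isSeparator [IsGrothendieckAbelian.{w} C]
    [EnoughInjectives D] (adj : T ⊣ R) {G : C} (hG : IsSeparator G)
    (h : ∀ P : Subobject G, Mono (T.map P.arrow)) : T.PreservesMonomorphisms where
  preserves {X Y} f _ := by
    -- Baer's criterion: injectivity of `R(I)` need only be tested on inclusions of subobjects of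
    -- `G`. By adjunction these extension problems become problems along `T.map P.arrow`, a
    -- monomorphism, with values in the injective `I`.
    have hI : Injective (R.obj (Injective.under (T.obj X))) := by
      rw [injective_iff_rlp_monomorphisms_zero,
        ← IsGrothendieckAbelian.generatingMonomorphisms_rlp.{w} hG]
      rintro _ _ _ ⟨P⟩
      have := h P
      refine ⟨fun {a b} sq => ⟨⟨⟨adj.homEquiv _ _
        (Injective.factorThru ((adj.homEquiv _ _).symm a) (T.map P.arrow)), ?_,
        (isZero_zero C).eq_of_tgt _ _⟩⟩⟩⟩
      rw [← adj.homEquiv_naturality_left, Injective.comp_factorThru, Equiv.apply_symm_apply]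
    -- The transpose of the embedding of `T(X)` into an injective extends along `f`; transposing
    -- back shows that this embedding factors through `T.map f`.
    let a := adj.homEquiv _ _ (Injective.ι (T.obj X))
    have : T.map f ≫ (adj.homEquiv _ _).symm (Injective.factorThru a f) =
        Injective.ι (T.obj X) := by
      rw [← adj.homEquiv_naturality_left_symm, Injective.comp_factorThru,
        Equiv.symm_apply_apply]
    exact mono_of_mono_fac this

/-- A functor between abelian categories is exact if it is a left adjoint and preserves
monomorphisms. -/
lemma preservesFiniteLimits_of_preservesMonomorphisms [Abelian D] [T.Additive] [T.IsLeftAdjoint]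
    [T.PreservesMonomorphisms] : PreservesFiniteLimits T := by
  refine T.preservesFiniteLimits_iff_forall_exact_map_and_mono.2 fun S hS => ?_
  have := hS.mono_f
  exact ⟨(T.preservesFiniteColimits_iff_forall_exact_map_and_epi.1 inferInstance S hS).1,
    inferInstance⟩

end Exact

/-! ### A module as the filtered union of its submodules with one generator -/

section Generated

variable {k : Type u} [CommRing k]

lemma exists_image_hom {C : Type u₁} [Category.{v₁} C] [HasImages C] {X Y K : C} {f : X ⟶ K}
    {g : Y ⟶ K} (p : X ⟶ Y) (h : p ≫ g = f) :
    ∃ t : image f ⟶ image g, t ≫ image.ι g = image.ι f :=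
  ⟨image.lift
    { I := image g
      m := image.ι g
      e := p ≫ factorThruImage g
      fac := by rw [Category.assoc, image.fac, h] }, image.lift_fac _⟩

/-- The submodule which an element generates. -/
noncomputable def generatedObj (K : Modules k (FpMod k)ᵒᵖ)
    (x : Σ N : FpMod k, K.obj.obj (op (op N))) : Modules k (FpMod k)ᵒᵖ :=
  image (yonedaLift k (FpMod k)ᵒᵖ K (op x.1) x.2)

/-- The inclusion of the submodule which an element generates. -/
noncomputable def generatedι (K : Modules k (FpMod k)ᵒᵖ)
    (x : Σ N : FpMod k, K.obj.obj (op (op N))) : generatedObj K x ⟶ K :=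
  image.ι (yonedaLift k (FpMod k)ᵒᵖ K (op x.1) x.2)

/-- The projection from a representable module to the submodule which an element generates. -/
noncomputable def generatedπ (K : Modules k (FpMod k)ᵒᵖ)
    (x : Σ N : FpMod k, K.obj.obj (op (op N))) :
    yonedaObj k (FpMod k)ᵒᵖ (op x.1) ⟶ generatedObj K x :=
  factorThruImage (yonedaLift k (FpMod k)ᵒᵖ K (op x.1) x.2)

instance (K : Modules k (FpMod k)ᵒᵖ) (x : Σ N : FpMod k, K.obj.obj (op (op N))) :
    Mono (generatedι K x) :=
  inferInstanceAs (Mono (image.ι (yonedaLift k (FpMod k)ᵒᵖ K (op x.1) x.2)))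

instance (K : Modules k (FpMod k)ᵒᵖ) (x : Σ N : FpMod k, K.obj.obj (op (op N))) :
    Epi (generatedπ K x) :=
  inferInstanceAs (Epi (factorThruImage (yonedaLift k (FpMod k)ᵒᵖ K (op x.1) x.2)))

lemma generatedπ_ι (K : Modules k (FpMod k)ᵒᵖ) (x : Σ N : FpMod k, K.obj.obj (op (op N))) :
    generatedπ K x ≫ generatedι K x = yonedaLift k (FpMod k)ᵒᵖ K (op x.1) x.2 :=
  image.fac _

/-- The subobject of a module which an element generates. -/
noncomputable def generated (K : Modules k (FpMod k)ᵒᵖ)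
    (x : Σ N : FpMod k, K.obj.obj (op (op N))) : MonoOver K :=
  MonoOver.mk (generatedι K x)

/-- If `p` carries `y` to `x`, the morphism from a representable given by `x` factors through the
one given by `y`, so its image is smaller. -/
lemma exists_generated_hom (K : Modules k (FpMod k)ᵒᵖ)
    (x y : Σ N : FpMod k, K.obj.obj (op (op N))) (p : y.1 ⟶ x.1)
    (h : K.obj.map p.op.op y.2 = x.2) : Nonempty (generated K x ⟶ generated K y) := by
  have hp : yonedaMap k p.op ≫ yonedaLift k (FpMod k)ᵒᵖ K (op y.1) y.2 =
      yonedaLift k (FpMod k)ᵒᵖ K (op x.1) x.2 := by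
    rw [map_yonedaLift, h]
  obtain ⟨t, ht⟩ := exists_image_hom _ hp
  exact ⟨MonoOver.homMk t ht⟩

/-- The subobjects generated by one element form a filtered category. -/
abbrev GeneratedIndex (K : Modules k (FpMod k)ᵒᵖ) := InducedCategory (MonoOver K) (generated K)

/-- Direct sums in `fpmod(k)` combine two generators into one: from `i x + j y` over the sum, the
projections `p` and `q` recover `x` and `y`. Parallel arrows agree because subobjects form a
preorder. -/
instance (K : Modules k (FpMod k)ᵒᵖ) : IsFiltered (GeneratedIndex K) where
  nonempty := ⟨⟨FpMod.unit k, 0⟩⟩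
  cocone_objs x y := by
    obtain ⟨P, i, j, p, q, hip, hjq, hiq, hjp⟩ := FpMod.exists_sum x.1 y.1
    have := K.property.1
    let z : Σ N : FpMod k, K.obj.obj (op (op N)) :=
      ⟨P, K.obj.map i.op.op x.2 + K.obj.map j.op.op y.2⟩
    have hz (W : FpMod k) (r : P ⟶ W) : K.obj.map r.op.op z.2 =
        K.obj.map (i ≫ r).op.op x.2 + K.obj.map (j ≫ r).op.op y.2 := by
      rw [op_comp, op_comp, op_comp, op_comp, K.obj.map_comp, K.obj.map_comp]
      exact map_add (K.obj.map r.op.op).hom _ _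
    obtain ⟨f⟩ := exists_generated_hom K x z p (by
      rw [hz, hip, hjp]
      simp)
    obtain ⟨g⟩ := exists_generated_hom K y z q (by
      rw [hz, hiq, hjq]
      simp)
    exact ⟨z, InducedCategory.homMk f, InducedCategory.homMk g, trivial⟩
  cocone_maps x y f g := ⟨y, 𝟙 y, by
    congr 1
    exact InducedCategory.hom_ext (Subsingleton.elim _ _)⟩

/-- Every module is the union of the submodules generated by one element. -/
lemma iSup_generated (K : Modules k (FpMod k)ᵒᵖ) :
    ⨆ x : GeneratedIndex K, Subobject.mk (generatedι K x) = ⊤ := by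
  set P := ⨆ x : GeneratedIndex K, Subobject.mk (generatedι K x)
  -- Each element of `K` lies in the submodule it generates, so the morphism representing it factors
  -- through `P`.
  have : Epi P.arrow := ⟨fun f g hfg => modules_hom_ext fun ⟨N⟩ x => by
    let j : GeneratedIndex K := ⟨N, x⟩
    have h1 : Subobject.mk (generatedι K j) ≤ P :=
      le_iSup (fun x : GeneratedIndex K => Subobject.mk (generatedι K x)) j
    have h2 : generatedπ K j ≫ Subobject.ofMkLE (generatedι K j) P h1 ≫ P.arrow =
        yonedaLift k (FpMod k)ᵒᵖ K (op N) x := by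
      rw [Subobject.ofMkLE_arrow]
      exact generatedπ_ι K j
    rw [← h2, Category.assoc, Category.assoc, Category.assoc, Category.assoc, hfg]⟩
  have : IsIso P.arrow := isIso_of_mono_of_epi _
  exact Subobject.eq_top_of_isIso_arrow P

/-- The cocone of the submodules generated by one element. -/
noncomputable def generatedCocone (K : Modules k (FpMod k)ᵒᵖ) :
    Cocone (inducedFunctor (generated K) ⋙ MonoOver.forget K) where
  pt := Over.mk (𝟙 K)
  ι :=
    { app := fun x => Over.homMk (generatedι K x)
      naturality := fun x y f => by
        apply Over.OverMorphism.ext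
        exact (MonoOver.w f.hom).trans (Category.comp_id _).symm }

/-- In a Grothendieck category a filtered union of subobjects is also their colimit, so a left
adjoint can be computed on it. -/
noncomputable def isColimitGeneratedCocone (K : Modules k (FpMod k)ᵒᵖ) :
    IsColimit ((Over.forget K).mapCocone (generatedCocone K)) :=
  haveI : Mono (generatedCocone K).pt.hom := inferInstanceAs (Mono (𝟙 K))
  IsGrothendieckAbelian.isColimitMapCoconeOfSubobjectMkEqISup _ _
    ((Subobject.mk_eq_top_of_isIso (𝟙 K)).trans (iSup_generated K).symm)

end Generated

/-! ### Functors of the form `N ↦ Hom(N, X)` -/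

section CotensorFunctor

variable {k : Type u} [CommRing k] {A : Type u₁} [Category.{v₁} A] [Preadditive A] [Linear k A]

/-- The linear family of morphisms `G(N) ⟶ G(k)` indexed by the elements of `N`. -/
noncomputable def elemMap (G : (FpMod k)ᵒᵖ ⥤ A) [G.Additive] [G.Linear k] (N : FpMod k) :
    FinPres.module k N →ₗ[k] (G.obj (op N) ⟶ G.obj (op (FpMod.unit k))) where
  toFun m := G.map (FpMod.elem N m).op
  map_add' m n := by rw [map_add, op_add, G.map_add]
  map_smul' r m := by
    rw [map_smul, RingHom.id_apply, ← G.map_smul]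
    rfl

lemma elemMap_apply (G : (FpMod k)ᵒᵖ ⥤ A) [G.Additive] [G.Linear k] (N : FpMod k)
    (m : FinPres.module k N) : elemMap G N m = G.map (FpMod.elem N m).op := rfl

lemma map_elemMap (G : (FpMod k)ᵒᵖ ⥤ A) [G.Additive] [G.Linear k] {M N : FpMod k} (f : M ⟶ N)
    (m : FinPres.module k M) : G.map f.op ≫ elemMap G M m = elemMap G N (f.hom.hom m) := by
  rw [elemMap_apply, elemMap_apply, ← G.map_comp, ← op_comp, FpMod.elem_comp]

/-- The functor `G` is of the form `N ↦ Hom(N, X)`, with `X = G(k)`. -/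
def IsCotensorFunctor (G : (FpMod k)ᵒᵖ ⥤ A) [G.Additive] [G.Linear k] : Prop :=
  ∀ N : FpMod k, IsCotensor (elemMap G N)

lemma IsCotensorFunctor.of_iso {G G' : (FpMod k)ᵒᵖ ⥤ A} [G.Additive] [G.Linear k] [G'.Additive]
    [G'.Linear k] (h : IsCotensorFunctor G) (e : G ≅ G') : IsCotensorFunctor G' := fun N =>
  { hom_ext := fun s t hst => by
      rw [← cancel_mono (e.inv.app _)]
      refine (h N).hom_ext _ _ fun m => ?_
      have := hst m
      rw [elemMap_apply] at this ⊢
      rw [Category.assoc, Category.assoc, ← e.inv.naturality, reassoc_of% this]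
    exists_lift := fun {Z} φ => by
      obtain ⟨s, hs⟩ := (h N).exists_lift ((Linear.rightComp k Z (e.inv.app _)) ∘ₗ φ)
      refine ⟨s ≫ e.hom.app _, fun m => ?_⟩
      have := hs m
      rw [elemMap_apply] at this ⊢
      rw [Category.assoc, ← e.hom.naturality, reassoc_of% this]
      simp }

/-- Cotensors by finitely presented modules are finite limits, hence are preserved by `T`. -/
lemma IsCotensorFunctor.comp {B : Type u₂} [Category.{v₂} B] [Preadditive B] [Linear k B]
    [HasFiniteBiproducts A] {G : (FpMod k)ᵒᵖ ⥤ A} [G.Additive] [G.Linear k]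
    (h : IsCotensorFunctor G) (T : A ⥤ B) [T.Additive] [T.Linear k] [PreservesFiniteLimits T] :
    IsCotensorFunctor (G ⋙ T) := fun N => by
  have : Module.FinitePresentation k (FinPres.module k N) := FinPres.finitePresentation k N
  exact (h N).map T

-- Sections over `M` of the module represented by `N` are linear maps `N → M`, while those of the
-- generic object are elements of `M`. A linear family indexed by `N` of morphisms from `F` to the
-- generic object therefore assigns to each `x ∈ F(M)` a linear map `N → M`, naturally in `M`.
variable (k) in
lemma isCotensorFunctor_yoneda : IsCotensorFunctor (yonedaFunctor k (FpMod k)ᵒᵖ) := fun N =>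
  { hom_ext := fun {F} s t hst => by
      ext M x
      let a : M.unop ⟶ op N := s.hom.app M x
      let b : M.unop ⟶ op N := t.hom.app M x
      suffices a = b from this
      apply Quiver.Hom.unop_inj
      apply InducedCategory.hom_ext
      ext m
      have h : a ≫ (FpMod.elem N m).op = b ≫ (FpMod.elem N m).op :=
        congr(($(hst m)).hom.app M x)
      have h' : FpMod.elem N m ≫ a.unop = FpMod.elem N m ≫ b.unop := congrArg Quiver.Hom.unop h
      rw [FpMod.elem_comp, FpMod.elem_comp] at h'
      rw [← FpMod.elem_one (a.unop.hom.hom m), h', FpMod.elem_one]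
    exists_lift := fun {F} φ => by
      let φ' (m : FinPres.module k N) (M : (FpMod k)ᵒᵖᵒᵖ) (x : F.obj.obj M) :
        M.unop ⟶ op (FpMod.unit k) := (φ m).hom.app M x
      have hφ' {M M' : (FpMod k)ᵒᵖᵒᵖ} (f : M ⟶ M') (m : FinPres.module k N) (x : F.obj.obj M) :
          φ' m M' (F.obj.map f x) = f.unop ≫ φ' m M x :=
        congr($((φ m).hom.naturality f) x)
      -- A section of the generic object over `M` is a morphism `k ⟶ M`; evaluating at the generator
      -- turns it into an element of `M`.
      let c (M : (FpMod k)ᵒᵖᵒᵖ) (x : F.obj.obj M) :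
          FinPres.module k N →ₗ[k] FinPres.module k M.unop.unop :=
        { toFun := fun m => (φ' m M x).unop.hom.hom FpMod.one
          map_add' := fun m n => by
            have : φ' (m + n) M x = φ' m M x + φ' n M x :=
              congr(($(φ.map_add m n)).hom.app M x)
            rw [this]
            rfl
          map_smul' := fun r m => by
            have : φ' (r • m) M x = r • φ' m M x :=
              congr(($(φ.map_smul r m)).hom.app M x)
            rw [this]
            rfl }
      let d (M : (FpMod k)ᵒᵖᵒᵖ) (x : F.obj.obj M) : M.unop ⟶ op N :=
        Quiver.Hom.op (InducedCategory.homMk (ModuleCat.ofHom (c M x)))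
      have hd {M : (FpMod k)ᵒᵖᵒᵖ} {x : F.obj.obj M} {f : M.unop ⟶ op N}
          (h : ∀ m, c M x m = f.unop.hom.hom m) : d M x = f := by
        apply Quiver.Hom.unop_inj
        apply InducedCategory.hom_ext
        ext m
        exact h m
      let s : F ⟶ yonedaObj k (FpMod k)ᵒᵖ (op N) := ObjectProperty.homMk
        { app := fun M => ModuleCat.ofHom (Y := (yonedaObj k (FpMod k)ᵒᵖ (op N)).obj.obj M)
            { toFun := d M
              map_add' := fun x y => hd fun m => by
                have : φ' m M (x + y) = φ' m M x + φ' m M y := map_add ((φ m).hom.app M).hom x y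
                change (φ' m M (x + y)).unop.hom.hom FpMod.one = _
                rw [this]
                rfl
              map_smul' := fun r x => hd fun m => by
                have : φ' m M (r • x) = r • φ' m M x := map_smul ((φ m).hom.app M).hom r x
                change (φ' m M (r • x)).unop.hom.hom FpMod.one = _
                rw [this]
                rfl }
          naturality := fun M M' f => by
            ext x
            refine hd fun m => ?_
            change (φ' m M' (F.obj.map f x)).unop.hom.hom FpMod.one = _
            rw [hφ']
            rfl }
      refine ⟨s, fun m => ?_⟩
      ext M x
      change d M x ≫ (FpMod.elem N m).op = φ' m M x
      apply Quiver.Hom.unop_inj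
      change FpMod.elem N m ≫ (d M x).unop = (φ' m M x).unop
      rw [FpMod.elem_comp, ← FpMod.elem_hom (φ' m M x).unop]
      rfl }

/-- Jointly, the morphisms induced by `M i ⟶ N` have a kernel which comes from a quotient of `N`. -/
lemma IsCotensorFunctor.exists_kernel {G : (FpMod k)ᵒᵖ ⥤ A} [G.Additive] [G.Linear k]
    (h : IsCotensorFunctor G) {ι : Type*} (S : Finset ι) {M : ι → FpMod k} {N : FpMod k}
    (p : ∀ i, M i ⟶ N) :
    ∃ (C : FpMod k) (q : N ⟶ C), (∀ i ∈ S, p i ≫ q = 0) ∧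
      ∀ {Z : A} (z : Z ⟶ G.obj (op N)), (∀ i ∈ S, z ≫ G.map (p i).op = 0) →
        ∃ z', z' ≫ G.map q.op = z := by
  -- The quotient `C` is `N / W`, the joint cokernel of the `p i`. It is finitely presented because
  -- finitely many images, each finitely generated, are summed.
  let W : Submodule k (FinPres.module k N) := ⨆ i ∈ S, LinearMap.range (p i).hom.hom
  have hW : W.FG := Submodule.fg_biSup S _ fun i _ => by
    have : Module.FinitePresentation k (FinPres.module k (M i)) := FinPres.finitePresentation k _
    exact Module.Finite.iff_fg.1 (Module.Finite.range (p i).hom.hom)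
  obtain ⟨C, q, hq, hker⟩ := FpMod.exists_quotient N W hW
  refine ⟨C, q, fun i hi => ?_, fun {Z} z hz => ?_⟩
  · apply InducedCategory.hom_ext
    ext m
    have : (p i).hom.hom m ∈ W :=
      (le_iSup₂_of_le i hi le_rfl : LinearMap.range (p i).hom.hom ≤ W) ⟨m, rfl⟩
    rw [← hker] at this
    exact this
  · let φ : FinPres.module k N →ₗ[k] (Z ⟶ G.obj (op (FpMod.unit k))) :=
      Linear.leftComp k _ z ∘ₗ elemMap G N
    have hφ (m : FinPres.module k N) : φ m = z ≫ elemMap G N m := rfl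
    -- Vanishing of `z` along every `p i` says that the linear family attached to `z` vanishes on
    -- `W`, so it descends to `C` and defines `z'`.
    have hle : LinearMap.ker q.hom.hom ≤ LinearMap.ker φ := by
      rw [hker]
      refine iSup₂_le fun i hi => ?_
      rintro _ ⟨m, rfl⟩
      rw [LinearMap.mem_ker, hφ, ← map_elemMap, reassoc_of% (hz i hi), zero_comp]
    let ψ : FinPres.module k C →ₗ[k] (Z ⟶ G.obj (op (FpMod.unit k))) :=
      Submodule.liftQ _ φ hle ∘ₗ (q.hom.hom.quotKerEquivOfSurjective hq).symm.toLinearMap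
    have hψ (m : FinPres.module k N) : ψ (q.hom.hom m) = φ m := by
      have : (q.hom.hom.quotKerEquivOfSurjective hq).symm (q.hom.hom m) = Submodule.Quotient.mk m :=
        (LinearEquiv.symm_apply_eq _).2 rfl
      simp [ψ, this]
    refine ⟨(h C).lift ψ, (h N).hom_ext _ _ fun m => ?_⟩
    rw [Category.assoc, map_elemMap, (h C).lift_ev, hψ, hφ]

end CotensorFunctor

/-! ### Exactness of the extension to modules -/

section Exactness

variable {k : Type u} [CommRing k] {A : Type u₁} [Category.{u} A] [Abelian A] [Linear k A]
  (T : Modules k (FpMod k)ᵒᵖ ⥤ A) [T.Additive] [T.Linear k]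

/-- Finitely many components of `y` suffice to detect vanishing after precomposition, and by Yoneda
each comes from a morphism of `fpmod(k)` into `N`. Their joint cokernel `C` serves both claims: its
representable is killed by `y`, and the cotensor property makes `T` of that representable catch
whatever `T.map y` kills. -/
lemma exists_representable_kernel (h : IsCotensorFunctor (yonedaFunctor k (FpMod k)ᵒᵖ ⋙ T))
    {N : FpMod k}
    (y : yonedaObj k (FpMod k)ᵒᵖ (op N) ⟶ ∐ (yonedaObj k (FpMod k)ᵒᵖ)) :
    ∃ (C : FpMod k) (q : N ⟶ C), yonedaMap k q.op ≫ y = 0 ∧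
      ∀ {Z : A} (z : Z ⟶ T.obj (yonedaObj k (FpMod k)ᵒᵖ (op N))), z ≫ T.map y = 0 →
        ∃ z' : Z ⟶ T.obj (yonedaObj k (FpMod k)ᵒᵖ (op C)),
          z' ≫ T.map (yonedaMap k q.op) = z := by
  classical
  obtain ⟨S, hS⟩ := exists_finset_detecting y
  let π (M : (FpMod k)ᵒᵖ) := y ≫ Sigma.π (yonedaObj k (FpMod k)ᵒᵖ) M
  choose p' hp' using fun M => exists_yonedaMap_eq (π M)
  let p (M : (FpMod k)ᵒᵖ) : M.unop ⟶ N := (p' M).unop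
  obtain ⟨C, q, hq, hz⟩ := h.exists_kernel S p
  refine ⟨C, q, hS _ fun M hM => ?_, fun {Z} z h => hz z fun M _ => ?_⟩
  · change _ ≫ π M = 0
    rw [← hp', ← yonedaMap_comp, ← yonedaMap_zero]
    exact congr(yonedaMap k $(hq M hM).op)
  · change z ≫ T.map (yonedaMap k (p' M)) = 0
    rw [hp', T.map_comp, reassoc_of% h, zero_comp]

/-- A left adjoint functor on modules whose restriction to representable modules is left exact is
exact. -/
lemma preservesFiniteLimits_of_isCotensorFunctor [IsGrothendieckAbelian.{u} A] [T.IsLeftAdjoint]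
    (h : IsCotensorFunctor (yonedaFunctor k (FpMod k)ᵒᵖ ⋙ T)) : PreservesFiniteLimits T := by
  have : T.PreservesMonomorphisms :=
    preservesMonomorphisms_of_isSeparator.{u} (Adjunction.ofIsLeftAdjoint T)
      (isSeparator_sigma_yonedaObj k (FpMod k)ᵒᵖ) fun P => by
    let K : Modules k (FpMod k)ᵒᵖ := P
    have key (x : GeneratedIndex K) : Mono (T.map (generatedι K x ≫ P.arrow)) := by
      refine Preadditive.mono_of_cancel_zero _ fun {Z} z hz => ?_
      -- As a left adjoint, `T` keeps `generatedπ K x` epi, so after a refinement of `Z` the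
      -- morphism `z` lifts to the value of `T` on a representable.
      obtain ⟨Z', π, _, z', hz'⟩ := surjective_up_to_refinements_of_epi (T.map (generatedπ K x)) z
      let y := generatedπ K x ≫ generatedι K x ≫ P.arrow
      obtain ⟨C, q, hq, hker⟩ := exists_representable_kernel T h y
      obtain ⟨w, hw⟩ := hker z' (by
        rw [T.map_comp, ← reassoc_of% hz', hz, comp_zero])
      -- The lift factors through `T` of the representable of `C`, which `y` kills; since `y` is
      -- `generatedπ K x` followed by a monomorphism, `generatedπ K x` kills it already.
      have hq' : yonedaMap k q.op ≫ generatedπ K x = 0 := by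
        rw [← cancel_mono (generatedι K x ≫ P.arrow), zero_comp, Category.assoc, hq]
      rw [← cancel_epi π, hz', ← hw, Category.assoc, ← T.map_comp, hq', T.map_zero, comp_zero,
        comp_zero]
    have hc := isColimitOfPreserves T (isColimitGeneratedCocone K)
    have hw {x y : GeneratedIndex K} (t : generatedObj K x ⟶ generatedObj K y)
        (ht : t ≫ generatedι K y = generatedι K x) :
        T.map t ≫ T.map (generatedι K y ≫ P.arrow) = T.map (generatedι K x ≫ P.arrow) ≫ 𝟙 _ := by
      rw [Category.comp_id, ← T.map_comp, ← Category.assoc, ht]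
    -- `T.map P.arrow` is the filtered colimit of the monomorphisms `key x`. The target diagram is
    -- constant, and its colimit is its value because a filtered category is connected.
    let α : (inducedFunctor (generated K) ⋙ MonoOver.forget K ⋙ Over.forget K) ⋙ T ⟶
        (Functor.const _).obj (T.obj (∐ (yonedaObj k (FpMod k)ᵒᵖ))) :=
      { app := fun x => T.map (generatedι K x ≫ P.arrow)
        naturality := fun x y f => hw f.hom.hom.left (MonoOver.w f.hom) }
    have (x : GeneratedIndex K) : Mono (α.app x) := key x
    have := NatTrans.mono_of_mono_app α
    have : IsConnected (GeneratedIndex K) := IsFiltered.isConnected _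
    exact colim.map_mono' α hc (isColimitConstCocone _ _) (T.map P.arrow) fun x =>
        ((T.map_comp _ _).symm.trans (Category.comp_id _).symm)
  exact preservesFiniteLimits_of_preservesMonomorphisms

end Exactness

/-! ### Transformations are determined by representables -/

section Extension

variable {k : Type u} [CommRing k] {𝔞 : Type u} [Category.{u} 𝔞] [Preadditive 𝔞] [Linear k 𝔞]

/-- The morphism of modules which a natural family of morphisms out of representable modules
determines. -/
def ofYoneda {F H : Modules k 𝔞} (β : ∀ X : 𝔞, F.obj.obj (op X) → (yonedaObj k 𝔞 X ⟶ H))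
    (add : ∀ X x y, β X (x + y) = β X x + β X y) (smul : ∀ X (r : k) x, β X (r • x) = r • β X x)
    (nat : ∀ {X Y : 𝔞} (t : Y ⟶ X) (x : F.obj.obj (op X)),
      β Y (F.obj.map t.op x) = yonedaMap k t ≫ β X x) : F ⟶ H :=
  ObjectProperty.homMk
    { app := fun X => ModuleCat.ofHom
        { toFun := fun x => (β X.unop x).hom.app X (𝟙 X.unop)
          map_add' := fun x y => by rw [add]; rfl
          map_smul' := fun r x => by rw [smul]; rfl }
      naturality := fun X Y t => by
        ext x
        change (β Y.unop (F.obj.map t x)).hom.app Y (𝟙 Y.unop) =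
          H.obj.map t ((β X.unop x).hom.app X (𝟙 X.unop))
        have h := congr($((β X.unop x).hom.naturality t) (𝟙 X.unop))
        have h' : β Y.unop (F.obj.map t x) = yonedaMap k t.unop ≫ β X.unop x := nat t.unop x
        rw [h']
        change (β X.unop x).hom.app Y (𝟙 Y.unop ≫ t.unop) = _
        rw [Category.id_comp, ← Category.comp_id t.unop]
        exact h }

lemma yonedaLift_ofYoneda {F H : Modules k 𝔞}
    (β : ∀ X : 𝔞, F.obj.obj (op X) → (yonedaObj k 𝔞 X ⟶ H)) (add smul) (nat) (X : 𝔞)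
    (x : F.obj.obj (op X)) :
    yonedaLift k 𝔞 F X x ≫ ofYoneda β add smul nat = β X x := by
  rw [yonedaLift_comp]
  exact yonedaLift_hom (β X x)

lemma yonedaLift_id (X : 𝔞) : yonedaLift k 𝔞 (yonedaObj k 𝔞 X) X (𝟙 X) = 𝟙 _ :=
  yonedaLift_hom (𝟙 (yonedaObj k 𝔞 X))

variable {A : Type u₁} [Category.{v₁} A] {T T' : Modules k 𝔞 ⥤ A} {R : A ⥤ Modules k 𝔞}

/-- A transformation out of a left adjoint functor is determined by its values on representable
modules. -/
lemma natTrans_ext_of_yoneda (adj : T ⊣ R) {α β : T ⟶ T'}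
    (h : ∀ X, α.app (yonedaObj k 𝔞 X) = β.app (yonedaObj k 𝔞 X)) : α = β := by
  ext F
  apply (adj.homEquiv _ _).injective
  refine modules_hom_ext fun X x => ?_
  rw [← adj.homEquiv_naturality_left, ← adj.homEquiv_naturality_left, α.naturality, β.naturality, h]

/-- A transformation between the restrictions to representable modules extends. -/
lemma exists_natTrans_of_yoneda [Preadditive A] [Linear k A] [R.Additive] [R.Linear k] [T.Additive]
    [T.Linear k] [T'.Additive] [T'.Linear k] (adj : T ⊣ R)
    (α : yonedaFunctor k 𝔞 ⋙ T ⟶ yonedaFunctor k 𝔞 ⋙ T') :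
    ∃ α' : T ⟶ T', ∀ X, α'.app (yonedaObj k 𝔞 X) = α.app X := by
  have homEquiv_add {F Z} (f g : T.obj F ⟶ Z) :
      adj.homEquiv _ _ (f + g) = adj.homEquiv _ _ f + adj.homEquiv _ _ g := by
    simp only [adj.homEquiv_unit, R.map_add, Preadditive.comp_add]
  have homEquiv_smul {F Z} (r : k) (f : T.obj F ⟶ Z) :
      adj.homEquiv _ _ (r • f) = r • adj.homEquiv _ _ f := by
    simp only [adj.homEquiv_unit, R.map_smul, Linear.comp_smul]
  let a (X : 𝔞) : T.obj (yonedaObj k 𝔞 X) ⟶ T'.obj (yonedaObj k 𝔞 X) := α.app X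
  have ha {X Y : 𝔞} (t : X ⟶ Y) : T.map (yonedaMap k t) ≫ a Y = a X ≫ T'.map (yonedaMap k t) :=
    α.naturality t
  -- Under the adjunction, a morphism `T(F) ⟶ T'(F)` is a morphism `F ⟶ R(T'(F))`. The latter can be
  -- given element by element, with no presentation of `F` as a colimit.
  let β (F : Modules k 𝔞) (X : 𝔞) (x : F.obj.obj (op X)) : yonedaObj k 𝔞 X ⟶ R.obj (T'.obj F) :=
    adj.homEquiv _ _ (a X ≫ T'.map (yonedaLift k 𝔞 F X x))
  let γ (F : Modules k 𝔞) : F ⟶ R.obj (T'.obj F) := ofYoneda (β F)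
    (fun X x y => by
      simp only [β]
      rw [yonedaLift_add, T'.map_add, Preadditive.comp_add, homEquiv_add])
    (fun X r x => by
      simp only [β]
      rw [yonedaLift_smul, T'.map_smul, Linear.comp_smul, homEquiv_smul])
    (fun {X Y} t x => by
      simp only [β]
      rw [← map_yonedaLift, T'.map_comp, ← reassoc_of% (ha t), adj.homEquiv_naturality_left])
  have hγ (F : Modules k 𝔞) (X : 𝔞) (x : F.obj.obj (op X)) :
      yonedaLift k 𝔞 F X x ≫ γ F = β F X x := yonedaLift_ofYoneda _ _ _ _ _ _
  refine ⟨{ app := fun F => (adj.homEquiv _ _).symm (γ F), naturality := fun F F' η => ?_ },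
    fun X => ?_⟩
  · apply (adj.homEquiv _ _).injective
    refine modules_hom_ext fun X x => ?_
    rw [adj.homEquiv_naturality_left, adj.homEquiv_naturality_right, Equiv.apply_symm_apply,
      Equiv.apply_symm_apply, reassoc_of% (hγ F X x), ← Category.assoc, yonedaLift_comp, hγ]
    simp only [β]
    rw [← adj.homEquiv_naturality_right, Category.assoc, ← T'.map_comp, yonedaLift_comp]
  · change (adj.homEquiv _ _).symm (γ _) = a X
    let x : (yonedaObj k 𝔞 X).obj.obj (op X) := 𝟙 X
    have hx : yonedaLift k 𝔞 _ X x = 𝟙 _ := yonedaLift_id X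
    rw [Equiv.symm_apply_eq, ← Category.id_comp (γ _), ← hx, hγ]
    simp only [β]
    rw [hx, T'.map_id, Category.comp_id]

end Extension

/-! ### The adjoint of the nerve extends the given functor -/

section NerveAdjoint

variable {k : Type u} [CommRing k] {𝔞 : Type u} [Category.{u} 𝔞] [Preadditive 𝔞] [Linear k 𝔞]
  {A : Type u₁} [Category.{u} A] [Preadditive A] [Linear k A]
  (G : 𝔞 ⥤ A) [G.Additive] [G.Linear k] {T : Modules k 𝔞 ⥤ A}

/-- A left adjoint of the nerve functor of `G` extends `G` along the Yoneda embedding. -/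
noncomputable def yonedaCompIso (adj : T ⊣ nerve k G) : yonedaFunctor k 𝔞 ⋙ T ≅ G := by
  -- By adjunction and Yoneda, `T(yonedaObj X)` and `G(X)` corepresent the same functor of `Z`; the
  -- isomorphism comes from the two identities.
  let e (X : 𝔞) (Z : A) : (T.obj (yonedaObj k 𝔞 X) ⟶ Z) ≃ (G.obj X ⟶ Z) :=
    (adj.homEquiv _ _).trans
      { toFun := fun f => f.hom.app (op X) (𝟙 X)
        invFun := fun x => yonedaLift k 𝔞 _ X x
        left_inv := fun f => yonedaLift_hom f
        right_inv := fun x => yonedaLift_app_id _ _ _ }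
  have he {X : 𝔞} {Z Z' : A} (f : T.obj (yonedaObj k 𝔞 X) ⟶ Z) (g : Z ⟶ Z') :
      e X Z' (f ≫ g) = e X Z f ≫ g :=
    congr(($(adj.homEquiv_naturality_right f g)).hom.app (op X) (𝟙 X))
  have he' {X Y : 𝔞} {Z : A} (t : Y ⟶ X) (f : T.obj (yonedaObj k 𝔞 X) ⟶ Z) :
      e Y Z (T.map (yonedaMap k t) ≫ f) = G.map t ≫ e X Z f := by
    have h1 := congr(($(adj.homEquiv_naturality_left (yonedaMap k t) f)).hom.app (op Y) (𝟙 Y))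
    have h2 := congr($((adj.homEquiv _ _ f).hom.naturality t.op) (𝟙 X))
    refine h1.trans ?_
    refine Eq.trans ?_ h2
    change (adj.homEquiv _ _ f).hom.app (op Y) (𝟙 Y ≫ t) =
      (adj.homEquiv _ _ f).hom.app (op Y) (t ≫ 𝟙 X)
    rw [Category.id_comp, Category.comp_id]
  let i (X : 𝔞) : T.obj (yonedaObj k 𝔞 X) ≅ G.obj X :=
    { hom := (e X _).symm (𝟙 _)
      inv := e X _ (𝟙 _)
      hom_inv_id := (e X _).injective (by
        rw [he, Equiv.apply_symm_apply, Category.id_comp])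
      inv_hom_id := by
        rw [← he, Category.id_comp, Equiv.apply_symm_apply] }
  have hi (X : 𝔞) : e X _ (i X).hom = 𝟙 _ := Equiv.apply_symm_apply _ _
  have hnat {X Y : 𝔞} (t : X ⟶ Y) : T.map (yonedaMap k t) ≫ (i Y).hom = (i X).hom ≫ G.map t :=
    (e X _).injective (by
      rw [he', he, hi, hi, Category.id_comp, Category.comp_id])
  exact NatIso.ofComponents i hnat

end NerveAdjoint

/-! ### Construction of `N ↦ Hom(N, X)` -/

section CotensorExistence

variable {k : Type u} [CommRing k] {A : Type u₁} [Category.{u} A] [Abelian A] [Linear k A]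

/-- For every object `X` there is a functor of the form `N ↦ Hom(N, X)`. -/
lemma exists_isCotensorFunctor [HasLimitsOfSize.{u, u} A] (X : A) :
    ∃ (G : (FpMod k)ᵒᵖ ⥤ A) (_ : G.Additive) (_ : G.Linear k), IsCotensorFunctor G ∧
      Nonempty (G.obj (op (FpMod.unit k)) ≅ X) := by
  choose P ev h using fun N : FpMod k => exists_isCotensor (k := k) (FinPres.module k N) X
  let G : (FpMod k)ᵒᵖ ⥤ A :=
    { obj := fun N => P N.unop
      map := fun {N N'} f => (h N'.unop).lift (ev N.unop ∘ₗ f.unop.hom.hom)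
      map_id := fun N => (h _).hom_ext _ _ fun m => by
        rw [IsCotensor.lift_ev, Category.id_comp]
        rfl
      map_comp := fun f g => (h _).hom_ext _ _ fun m => by
        rw [IsCotensor.lift_ev, Category.assoc, IsCotensor.lift_ev]
        exact ((h _).lift_ev (ev _ ∘ₗ f.unop.hom.hom) (g.unop.hom.hom m)).symm }
  have hmap {N N' : FpMod k} (f : N ⟶ N') (m : FinPres.module k N) :
      G.map f.op ≫ ev N m = ev N' (f.hom.hom m) := (h N).lift_ev _ _
  have hadd : G.Additive := ⟨fun {X Y f g} => (h _).hom_ext _ _ fun m => by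
    rw [Preadditive.add_comp]
    refine (hmap _ _).trans (Eq.trans ?_ congr($(hmap f.unop m) + $(hmap g.unop m)).symm)
    exact (ev _).map_add _ _⟩
  have hlin : G.Linear k := ⟨fun {X Y} f r => (h _).hom_ext _ _ fun m => by
    rw [Linear.smul_comp]
    refine (hmap _ _).trans (Eq.trans ?_ congr(r • $(hmap f.unop m)).symm)
    exact (ev _).map_smul _ _⟩
  let p : P (FpMod.unit k) ⟶ X := ev _ FpMod.one
  -- The inverse of `p` corresponds to the family `r ↦ r • 𝟙 X`, once the free module of rank one is
  -- identified with `k`.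
  let q : X ⟶ P (FpMod.unit k) := (h _).lift
    (LinearMap.toSpanSingleton k _ (𝟙 X) ∘ₗ (FpMod.unitEquiv k).toLinearMap)
  have hq (x : FinPres.module k (FpMod.unit k)) : q ≫ ev _ x = FpMod.unitEquiv k x • 𝟙 X :=
    (h _).lift_ev _ _
  let i : P (FpMod.unit k) ≅ X :=
    { hom := p
      inv := q
      hom_inv_id := (h _).hom_ext _ _ fun x => by
        rw [Category.assoc, hq, Linear.comp_smul, Category.comp_id, Category.id_comp, ← map_smul,
          ← FpMod.eq_smul_one]
      inv_hom_id := by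
        rw [hq]
        simp [FpMod.one] }
  -- The family `elemMap G N` differs from `ev N` only by the isomorphism `p`, so it inherits the
  -- universal property.
  have hp (N : FpMod k) (m : FinPres.module k N) : elemMap G N m ≫ p = ev N m :=
    (hmap _ _).trans (congrArg _ (FpMod.elem_one m))
  refine ⟨G, hadd, hlin, fun N => ⟨fun s t hst => (h N).hom_ext _ _ fun m => ?_, fun {Z} φ => ?_⟩,
    ⟨i⟩⟩
  · rw [← hp, reassoc_of% (hst m)]
  · obtain ⟨s, hs⟩ := (h N).exists_lift (Linear.rightComp k Z p ∘ₗ φ)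
    refine ⟨s, fun m => ?_⟩
    have : Mono p := mono_of_mono_fac (show p ≫ q = 𝟙 _ from i.hom_inv_id)
    exact (cancel_mono p).1 <|
      (Category.assoc _ _ _).trans ((congrArg (s ≫ ·) (hp N m)).trans (hs m))

end CotensorExistence

/-! ### Transformations into a cotensor functor -/

section HomIntoCotensor

variable {k : Type u} [CommRing k] {A : Type u₁} [Category.{v₁} A] [Preadditive A] [Linear k A]
  {G G' : (FpMod k)ᵒᵖ ⥤ A} [G.Additive] [G.Linear k] [G'.Additive] [G'.Linear k]

lemma elemMap_unit (G : (FpMod k)ᵒᵖ ⥤ A) [G.Additive] [G.Linear k]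
    (m : FinPres.module k (FpMod.unit k)) :
    elemMap G (FpMod.unit k) m = FpMod.unitEquiv k m • 𝟙 _ := by
  have h : elemMap G (FpMod.unit k) FpMod.one = 𝟙 _ := by
    have := FpMod.elem_hom (𝟙 (FpMod.unit k))
    rw [elemMap_apply, ← G.map_id, ← op_id, ← this]
    rfl
  conv_lhs => rw [FpMod.eq_smul_one m, map_smul, h]

lemma app_comp_elemMap (α : G ⟶ G') (N : FpMod k) (m : FinPres.module k N) :
    α.app (op N) ≫ elemMap G' N m = elemMap G N m ≫ α.app (op (FpMod.unit k)) :=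
  (α.naturality _).symm

/-- Naturality along the elements `k ⟶ N` expresses the component at `N`, followed by each
evaluation, through the component at `k`; evaluations are jointly monic on a cotensor. -/
lemma IsCotensorFunctor.natTrans_ext (h : IsCotensorFunctor G') {α β : G ⟶ G'}
    (hu : α.app (op (FpMod.unit k)) = β.app (op (FpMod.unit k))) : α = β := by
  ext N
  refine (h N.unop).hom_ext _ _ fun m => ?_
  exact (app_comp_elemMap α _ m).trans
    ((congrArg (elemMap G N.unop m ≫ ·) hu).trans (app_comp_elemMap β _ m).symm)

/-- Only the target must be a cotensor functor: the component at `N` is the lift of the family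
`elemMap G N` followed by `φ`, and uniqueness of lifts gives naturality. -/
lemma IsCotensorFunctor.exists_natTrans (h : IsCotensorFunctor G')
    (φ : G.obj (op (FpMod.unit k)) ⟶ G'.obj (op (FpMod.unit k))) :
    ∃ α : G ⟶ G', α.app (op (FpMod.unit k)) = φ := by
  let a (N : FpMod k) : G.obj (op N) ⟶ G'.obj (op N) :=
    (h N).lift (Linear.rightComp k _ φ ∘ₗ elemMap G N)
  have ha (N : FpMod k) (m : FinPres.module k N) : a N ≫ elemMap G' N m = elemMap G N m ≫ φ :=
    (h N).lift_ev _ _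
  refine ⟨{ app := fun N => a N.unop, naturality := fun N N' t => ?_ },
    (h _).hom_ext _ _ fun m => ?_⟩
  · refine (h N'.unop).hom_ext _ _ fun m => ?_
    have h1 := map_elemMap G t.unop m
    have h2 := map_elemMap G' t.unop m
    calc (G.map t ≫ a N'.unop) ≫ elemMap G' _ m
        = (G.map t.unop.op ≫ elemMap G _ m) ≫ φ := by
          rw [Category.assoc, ha, Category.assoc]; rfl
      _ = a N.unop ≫ (G'.map t.unop.op ≫ elemMap G' _ m) := by rw [h1, h2, ha]
      _ = _ := (Category.assoc _ _ _).symm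
  · refine (ha _ m).trans ?_
    rw [elemMap_unit, elemMap_unit, Linear.smul_comp, Linear.comp_smul, Category.id_comp,
      Category.comp_id]

end HomIntoCotensor

/-! ### Flat morphisms and their values at the generic object -/

section EvalGeneric

variable {k : Type u} [CommRing k]

variable (k) in
/-- The generic object of `Mod(k)[𝕆]`. -/
noncomputable abbrev genericObj : Modules k (FpMod k)ᵒᵖ := yonedaObj k (FpMod k)ᵒᵖ (op (FpMod.unit k))

section
variable {A : Type u₁} [Category.{v₁} A] [Preadditive A] [Linear k A]
  {T T' : Modules k (FpMod k)ᵒᵖ ⥤ A} [T.Additive] [T.Linear k] [T'.Additive]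
  [T'.Linear k] [PreservesFiniteLimits T'] {R : A ⥤ Modules k (FpMod k)ᵒᵖ}

/-- Two reductions: from all modules to representables, since `T` is a left adjoint, and from
representables to the generic one, since left exactness of `T'` makes its restriction a cotensor
functor. -/
lemma natTrans_ext_of_generic (adj : T ⊣ R) {α β : T ⟶ T'}
    (h : α.app (genericObj k) = β.app (genericObj k)) : α = β := by
  have : HasFiniteBiproducts (Modules k (FpMod k)ᵒᵖ) := .of_hasFiniteProducts
  have hc : IsCotensorFunctor (yonedaFunctor k (FpMod k)ᵒᵖ ⋙ T') :=
    (isCotensorFunctor_yoneda k).comp T'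
  have he : Functor.whiskerLeft (yonedaFunctor k (FpMod k)ᵒᵖ) α =
      Functor.whiskerLeft (yonedaFunctor k (FpMod k)ᵒᵖ) β := hc.natTrans_ext h
  exact natTrans_ext_of_yoneda adj fun X => congr($(he).app X)

lemma exists_natTrans_of_generic [R.Additive] [R.Linear k] (adj : T ⊣ R)
    (φ : T.obj (genericObj k) ⟶ T'.obj (genericObj k)) :
    ∃ α : T ⟶ T', α.app (genericObj k) = φ := by
  have : HasFiniteBiproducts (Modules k (FpMod k)ᵒᵖ) := .of_hasFiniteProducts
  have hc : IsCotensorFunctor (yonedaFunctor k (FpMod k)ᵒᵖ ⋙ T') :=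
    (isCotensorFunctor_yoneda k).comp T'
  obtain ⟨α, hα⟩ := hc.exists_natTrans (G := yonedaFunctor k (FpMod k)ᵒᵖ ⋙ T) φ
  obtain ⟨α', h'⟩ := exists_natTrans_of_yoneda adj α
  exact ⟨α', (h' _).trans hα⟩

end

/-- The functor given by the adjoint functor theorem carries no scalar compatibility of its own;
transposing across the adjunction moves the claim to `G`. -/
lemma linear_of_leftAdjoint {C : Type u₁} {D : Type u₂} [Category.{v₁} C] [Category.{v₂} D]
    [Preadditive C] [Preadditive D] [Linear k C] [Linear k D] {F : C ⥤ D} {G : D ⥤ C}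
    [F.Additive] [G.Additive] [G.Linear k] (adj : F ⊣ G) : F.Linear k :=
  ⟨fun f r => (adj.homEquiv _ _).injective (by
    rw [adj.homEquiv_unit, adj.homEquiv_unit, G.map_smul, Linear.comp_smul,
      adj.unit_naturality, adj.unit_naturality, Linear.smul_comp])⟩

/-- Every object of a Grothendieck category is the pullback of the generic object along a flat
morphism. -/
lemma exists_flatMorphism {A : GrtFlat.{u} k} (X : A.carrier) :
    ∃ f : FlatMorphism A (objectClassifier k), Nonempty (f.upperStar.obj.obj (genericObj k) ≅ X) := by
  obtain ⟨G, _, _, hG, ⟨e⟩⟩ := exists_isCotensorFunctor (k := k) X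
  -- The special adjoint functor theorem applies because a Grothendieck category has a coseparator.
  have : (nerve k G).IsRightAdjoint :=
    isRightAdjoint_of_preservesLimits_of_isCoseparating
      (isCoseparator_coseparator A.carrier) (nerve k G)
  let adj := Adjunction.ofIsRightAdjoint (nerve k G)
  let T : Modules k (FpMod k)ᵒᵖ ⥤ A.carrier := (nerve k G).leftAdjoint
  have : T.Additive := adj.left_adjoint_additive
  have : T.Linear k := linear_of_leftAdjoint adj
  let i := yonedaCompIso G adj
  exact ⟨{ upperStar := ⟨T, ‹_›, ‹_›⟩
           lowerStar := ⟨nerve k G, inferInstanceAs (nerve k G).Additive,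
             inferInstanceAs ((nerve k G).Linear k)⟩
           adj := adj
           exact := preservesFiniteLimits_of_isCotensorFunctor T (hG.of_iso i.symm) },
    ⟨i.app (op (FpMod.unit k)) ≪≫ e⟩⟩

section
variable {A : GrtFlat.{u} k} (f : FlatMorphism A (objectClassifier k))

/-- The inverse image functor, as a functor on `Mod(fpmod(k)ᵒᵖ)`. -/
def inverseImage : Modules k (FpMod k)ᵒᵖ ⥤ A.carrier := f.upperStar.obj

/-- The direct image functor, as a functor to `Mod(fpmod(k)ᵒᵖ)`. -/
def directImage : A.carrier ⥤ Modules k (FpMod k)ᵒᵖ := f.lowerStar.obj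

instance : (inverseImage f).Additive := f.upperStar.property.1

instance : (inverseImage f).Linear k := f.upperStar.property.2

instance : (directImage f).Additive := f.lowerStar.property.1

instance : (directImage f).Linear k := f.lowerStar.property.2

instance : PreservesFiniteLimits (inverseImage f) := f.exact

/-- The adjunction between inverse and direct image. -/
def inverseImageAdj : inverseImage f ⊣ directImage f := f.adj

end

section
variable {A : GrtFlat.{u} k} {f g h : FlatMorphism A (objectClassifier k)}

/-- The value of a 2-cell at the generic object. -/
noncomputable def atGeneric (η : f ⟶ g) :
    f.upperStar.obj.obj (genericObj k) ⟶ g.upperStar.obj.obj (genericObj k) :=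
  η.hom.hom.app (genericObj k)

/-- This faithfulness reduces the later equations between 2-cells into the classifier to equations
in `A`. -/
lemma hom_ext_of_atGeneric {η θ : f ⟶ g} (h : atGeneric η = atGeneric θ) : η = θ :=
  FlatMorphism.Hom.ext (ObjectProperty.hom_ext _
    (natTrans_ext_of_generic (T' := inverseImage g) (inverseImageAdj f) h))

lemma exists_atGeneric_eq
    (φ : f.upperStar.obj.obj (genericObj k) ⟶ g.upperStar.obj.obj (genericObj k)) :
    ∃ η : f ⟶ g, atGeneric η = φ := by
  obtain ⟨α, hα⟩ := exists_natTrans_of_generic (T' := inverseImage g) (inverseImageAdj f) φ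
  exact ⟨⟨ObjectProperty.homMk α⟩, hα⟩

/-- The 2-cell with a given value at the generic object. -/
noncomputable def homOfGeneric
    (φ : f.upperStar.obj.obj (genericObj k) ⟶ g.upperStar.obj.obj (genericObj k)) : f ⟶ g :=
  (exists_atGeneric_eq φ).choose

lemma atGeneric_homOfGeneric
    (φ : f.upperStar.obj.obj (genericObj k) ⟶ g.upperStar.obj.obj (genericObj k)) :
    atGeneric (homOfGeneric φ) = φ :=
  (exists_atGeneric_eq φ).choose_spec

lemma atGeneric_id : atGeneric (𝟙 f) = 𝟙 _ := rfl

lemma atGeneric_comp (η : f ⟶ g) (θ : g ⟶ h) : atGeneric (η ≫ θ) = atGeneric η ≫ atGeneric θ :=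
  rfl

/-- The invertible 2-cell with a given value at the generic object. -/
noncomputable def isoOfGeneric
    (e : f.upperStar.obj.obj (genericObj k) ≅ g.upperStar.obj.obj (genericObj k)) : f ≅ g where
  hom := homOfGeneric e.hom
  inv := homOfGeneric e.inv
  hom_inv_id := hom_ext_of_atGeneric (by
    rw [atGeneric_comp, atGeneric_homOfGeneric, atGeneric_homOfGeneric, e.hom_inv_id, atGeneric_id])
  inv_hom_id := hom_ext_of_atGeneric (by
    rw [atGeneric_comp, atGeneric_homOfGeneric, atGeneric_homOfGeneric, e.inv_hom_id, atGeneric_id])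

/-- The flat morphism which classifies an object. -/
noncomputable def classifying (X : A.carrier) : FlatMorphism A (objectClassifier k) :=
  (exists_flatMorphism X).choose

/-- The generic object pulls back to a given object along its classifying morphism. -/
noncomputable def classifyingIso (X : A.carrier) :
    (classifying X).upperStar.obj.obj (genericObj k) ≅ X :=
  (exists_flatMorphism X).choose_spec.some

end

end EvalGeneric

/-! ### The pseudonatural equivalence -/

section Representability

variable {k : Type u} [CommRing k]

/-- Evaluation of the inverse image functor at the generic object. -/
noncomputable def evalGeneric (A : GrtFlat.{u} k) :
    LinFunctor k (FlatMorphism A (objectClassifier k)) (ULiftHom.{u + 1} A.carrier) where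
  obj :=
    { obj := fun f => ULiftHom.objUp (f.upperStar.obj.obj (genericObj k))
      map := fun η => ULift.up (atGeneric η)
      map_id := fun _ => rfl
      map_comp := fun _ _ => rfl }
  property := ⟨⟨rfl⟩, ⟨fun _ _ => rfl⟩⟩

/-- The functor which sends an object to its classifying morphism. -/
noncomputable def classify (A : GrtFlat.{u} k) :
    LinFunctor k (ULiftHom.{u + 1} A.carrier) (FlatMorphism A (objectClassifier k)) where
  obj :=
    { obj := fun X => classifying X.objDown
      map := fun {X Y} φ => homOfGeneric
        ((classifyingIso X.objDown).hom ≫ φ.down ≫ (classifyingIso Y.objDown).inv)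
      map_id := fun X => hom_ext_of_atGeneric <| (atGeneric_homOfGeneric _).trans <| by
        change _ ≫ 𝟙 X.objDown ≫ _ = 𝟙 _
        rw [Category.id_comp, Iso.hom_inv_id]
      map_comp := fun {X Y Z} φ ψ => hom_ext_of_atGeneric <| (atGeneric_homOfGeneric _).trans <| by
        rw [atGeneric_comp, atGeneric_homOfGeneric, atGeneric_homOfGeneric]
        change _ ≫ (φ.down ≫ ψ.down) ≫ _ = _
        simp only [Category.assoc, Iso.inv_hom_id_assoc] }
  property :=
    ⟨⟨fun {X Y φ ψ} => hom_ext_of_atGeneric <| (atGeneric_homOfGeneric _).trans <| by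
      change _ ≫ (φ.down + ψ.down) ≫ _ = atGeneric (homOfGeneric _) + atGeneric (homOfGeneric _)
      rw [atGeneric_homOfGeneric, atGeneric_homOfGeneric, Preadditive.add_comp,
        Preadditive.comp_add]⟩,
    ⟨fun {X Y} φ r => hom_ext_of_atGeneric <| (atGeneric_homOfGeneric _).trans <| by
      change _ ≫ (r • φ.down) ≫ _ = r • atGeneric (homOfGeneric _)
      rw [atGeneric_homOfGeneric, Linear.smul_comp, Linear.comp_smul]⟩⟩

lemma atGeneric_classify_map {A : GrtFlat.{u} k} {X Y : ULiftHom.{u + 1} A.carrier} (φ : X ⟶ Y) :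
    atGeneric ((classify A).obj.map φ) =
      (classifyingIso X.objDown).hom ≫ φ.down ≫ (classifyingIso Y.objDown).inv :=
  atGeneric_homOfGeneric _

lemma id_comp_id_eq {C : Type u₁} [Category.{v₁} C] (X : C) : 𝟙 X ≫ 𝟙 X = 𝟙 X ≫ 𝟙 X ≫ 𝟙 X := by
  simp

lemma id_comp_six_eq {C : Type u₁} [Category.{v₁} C] {X : C} {f : X ⟶ X} (h : f = 𝟙 X) :
    𝟙 X ≫ 𝟙 X = 𝟙 X ≫ 𝟙 X ≫ 𝟙 X ≫ 𝟙 X ≫ f ≫ 𝟙 X := by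
  simp [h]

variable (k) in
/-- Evaluation at the generic object, as a pseudonatural transformation. -/
noncomputable def evalGenericTrans :
    GrtFlat.homTo (objectClassifier k) ⟶ GrtFlat.forget k where
  app A := evalGeneric A.unop
  -- Since `(f ≫ g)^*` is by definition `g^*` followed by `f^*`, evaluation commutes with
  -- precomposition strictly, and the components can be identities.
  naturality _ := ObjectProperty.isoMk _ (NatIso.ofComponents (fun _ => Iso.refl _) fun _ =>
    (Category.comp_id _).trans (Category.id_comp _).symm)
  naturality_naturality _ := LinFunctor.hom_ext fun _ =>
    (Category.comp_id _).trans (Category.id_comp _).symm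
  naturality_id _ := LinFunctor.hom_ext fun f =>
    id_comp_id_eq (ULiftHom.objUp (f.upperStar.obj.obj (genericObj k)))
  naturality_comp {_ _ C} _ g := LinFunctor.hom_ext fun _ =>
    id_comp_six_eq (C := ULiftHom.{u + 1} C.unop.carrier)
      (g.unop.upperStar.uliftHom.obj.map_id _)

section
variable {C : Type u₁} {D : Type u₂} {D' : Type u₃} [Category.{v₁} C] [Category.{v₂} D]
  [Category.{v₃} D']

/-- Here and in the following lemmas, the isomorphisms `i`, `j`, `p`, `q` stand for instances of
`classifyingIso`. The naturality and coherence laws of the inverse, evaluated at the generic object,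
become these cancellations. -/
lemma conj_naturality (F : D ⥤ C) {X Y X' Y' : D} {P Q : C} (φ : X ⟶ Y) (i : P ≅ F.obj X)
    (j : Q ≅ F.obj Y) (p : X' ≅ X) (q : Y' ≅ Y) :
    (i.hom ≫ F.map φ ≫ j.inv) ≫ j.hom ≫ F.map q.inv =
      (i.hom ≫ F.map p.inv) ≫ F.map (p.hom ≫ φ ≫ q.inv) := by
  simp only [Category.assoc, Iso.inv_hom_id_assoc, ← F.map_comp]

lemma conj_whisker {F G : D ⥤ C} (α : F ⟶ G) {X X' : D} {P Q : C} (i : P ≅ F.obj X)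
    (j : Q ≅ G.obj X) (p : X' ≅ X) :
    (i.hom ≫ α.app X ≫ j.inv) ≫ j.hom ≫ G.map p.inv = (i.hom ≫ F.map p.inv) ≫ α.app X' := by
  simp

lemma conj_id {X P : C} (i : P ≅ X) :
    (i.hom ≫ i.inv) ≫ 𝟙 _ = (i.hom ≫ 𝟙 _ ≫ i.inv) ≫ 𝟙 _ ≫ 𝟙 _ := by
  simp

lemma conj_comp (F : D ⥤ C) (G : D' ⥤ D) {X X' : D'} {Q : D} {P : C} (i : P ≅ F.obj (G.obj X))
    (j : Q ≅ G.obj X) (p : X' ≅ X) :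
    (i.hom ≫ F.map (G.map p.inv)) ≫ 𝟙 _ =
      (i.hom ≫ 𝟙 _ ≫ i.inv) ≫ 𝟙 _ ≫ (i.hom ≫ F.map j.inv) ≫ 𝟙 _ ≫
        F.map (j.hom ≫ G.map p.inv) ≫ 𝟙 _ := by
  simp only [Category.comp_id, Category.id_comp, Category.assoc, ← F.map_comp,
    Iso.inv_hom_id_assoc]

lemma conj_counit_naturality {X Y P Q : C} (φ : X ⟶ Y) (i : P ≅ X) (j : Q ≅ Y) :
    (i.hom ≫ φ ≫ j.inv) ≫ j.hom = i.hom ≫ φ := by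
  simp

lemma conj_counit (F : D ⥤ C) {X X' : D} {P : C} (i : P ≅ F.obj X) (p : X' ≅ X) :
    i.hom ≫ 𝟙 _ ≫ 𝟙 _ =
      (𝟙 _ ≫ (i.hom ≫ F.map p.inv) ≫ 𝟙 _ ≫ 𝟙 _ ≫ 𝟙 _) ≫ F.map p.hom := by
  simp [← F.map_comp]

lemma conj_unit_naturality {X Y P Q : C} (φ : X ⟶ Y) (i : P ≅ X) (j : Q ≅ Y) :
    φ ≫ j.inv = i.inv ≫ i.hom ≫ φ ≫ j.inv := by
  simp

lemma conj_unit (F : D ⥤ C) {X X' : D} {P : C} (i : P ≅ F.obj X) (p : X' ≅ X) :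
    i.inv ≫ 𝟙 _ ≫ (i.hom ≫ 𝟙 _ ≫ i.inv) ≫ 𝟙 _ ≫ (i.hom ≫ F.map p.inv) ≫ 𝟙 _ =
      (𝟙 _ ≫ 𝟙 _) ≫ F.map p.inv := by
  simp

end

/-- The classifying morphism of a pullback. -/
noncomputable def classifyingPullbackIso {A B : GrtFlat.{u} k} (f : FlatMorphism A B)
    (X : B.carrier) :
    classifying (f.upperStar.obj.obj X) ≅ f.comp (classifying X) :=
  isoOfGeneric (classifyingIso _ ≪≫ f.upperStar.obj.mapIso (classifyingIso X).symm)

lemma atGeneric_classifyingPullbackIso {A B : GrtFlat.{u} k} (f : FlatMorphism A B)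
    (X : B.carrier) :
    atGeneric (classifyingPullbackIso f X).hom =
      (classifyingIso _).hom ≫ f.upperStar.obj.map (classifyingIso X).inv :=
  atGeneric_homOfGeneric _

/-- Classifying morphisms are compatible with pullback. -/
noncomputable def classifyPullbackIso {A B : GrtFlat.{u} k} (f : FlatMorphism A B) :
    f.upperStar.uliftHom.comp (classify A) ≅ (classify B).comp (f.precomp (objectClassifier k)) :=
  ObjectProperty.isoMk _ (NatIso.ofComponents (fun X => classifyingPullbackIso f X.objDown)
    fun {X Y} φ => hom_ext_of_atGeneric <| by
      have h₁ := atGeneric_classify_map (f.upperStar.uliftHom.obj.map φ)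
      have h₂ := atGeneric_classify_map φ
      have h₃ := atGeneric_classifyingPullbackIso f X.objDown
      have h₄ := atGeneric_classifyingPullbackIso f Y.objDown
      refine congr($h₁ ≫ $h₄).trans (Eq.trans ?_ congr($h₃ ≫ f.upperStar.obj.map $h₂).symm)
      exact conj_naturality f.upperStar.obj φ.down _ _ _ _)

lemma atGeneric_classifyPullbackIso_app {A B : GrtFlat.{u} k} (f : FlatMorphism A B)
    (X : ULiftHom.{u + 1} B.carrier) :
    atGeneric ((classifyPullbackIso f).hom.hom.app X) =
      (classifyingIso _).hom ≫ f.upperStar.obj.map (classifyingIso X.objDown).inv :=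
  atGeneric_classifyingPullbackIso _ _

variable (k) in
/-- The formation of classifying morphisms, as a pseudonatural transformation. -/
noncomputable def classifyTrans :
    GrtFlat.forget k ⟶ GrtFlat.homTo (objectClassifier k) where
  app A := classify A.unop
  naturality f := classifyPullbackIso f.unop
  naturality_naturality {A B f g} η := LinFunctor.hom_ext fun X => hom_ext_of_atGeneric <| by
    have h₁ := atGeneric_classify_map ((LinFunctor.uliftHomMap η.unop2.hom).hom.app X)
    have h₂ := atGeneric_classifyPullbackIso_app g.unop X
    have h₃ := atGeneric_classifyPullbackIso_app f.unop X
    refine congr($h₁ ≫ $h₂).trans (Eq.trans ?_ congr($h₃ ≫ _).symm)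
    exact conj_whisker η.unop2.hom.hom _ _ _
  naturality_id A := LinFunctor.hom_ext fun (X : ULiftHom.{u + 1} A.unop.carrier) =>
      hom_ext_of_atGeneric <| by
    have h₁ := atGeneric_classifyPullbackIso_app (FlatMorphism.id A.unop) X
    have h₂ := atGeneric_classify_map (𝟙 X)
    refine congr($h₁ ≫ _).trans (Eq.trans ?_ congr($h₂ ≫ _).symm)
    exact conj_id (classifyingIso X.objDown)
  naturality_comp {A B C} f g := LinFunctor.hom_ext fun X => hom_ext_of_atGeneric <| by
    let Y : ULiftHom.{u + 1} B.unop.carrier := f.unop.upperStar.uliftHom.obj.obj X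
    let Z : ULiftHom.{u + 1} C.unop.carrier := g.unop.upperStar.uliftHom.obj.obj Y
    have h₁ := atGeneric_classifyPullbackIso_app (g.unop.comp f.unop) X
    have h₂ := atGeneric_classify_map (𝟙 Z)
    have h₃ := atGeneric_classifyPullbackIso_app g.unop Y
    have h₄ := atGeneric_classifyPullbackIso_app f.unop X
    refine congr($h₁ ≫ _).trans (Eq.trans ?_
      congr($h₂ ≫ 𝟙 _ ≫ $h₃ ≫ 𝟙 _ ≫ g.unop.upperStar.obj.map $h₄ ≫ 𝟙 _).symm)
    exact conj_comp g.unop.upperStar.obj f.unop.upperStar.obj _ _ _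

/-- The object which a classifying morphism classifies. -/
noncomputable def classifyCompEvalIso (A : GrtFlat.{u} k) :
    (classify A).comp (evalGeneric A) ≅ LinFunctor.id k (ULiftHom.{u + 1} A.carrier) :=
  ObjectProperty.isoMk _ (NatIso.ofComponents
    (fun X =>
      { hom := ULift.up (classifyingIso X.objDown).hom
        inv := ULift.up (classifyingIso X.objDown).inv
        hom_inv_id := ULift.ext _ _ (classifyingIso X.objDown).hom_inv_id
        inv_hom_id := ULift.ext _ _ (classifyingIso X.objDown).inv_hom_id })
    fun {X Y} φ => ULift.ext _ _ <| by
      have h := atGeneric_classify_map φ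
      exact congr($h ≫ _).trans (conj_counit_naturality φ.down _ _))

variable (k) in
/-- Classifying morphisms are inverse to evaluation at the generic object. -/
noncomputable def classifyCompEval : classifyTrans k ≫ evalGenericTrans k ≅ 𝟙 (GrtFlat.forget k) :=
  Pseudofunctor.StrongTrans.isoMk (fun A => classifyCompEvalIso A.unop)
    fun {A B} f => LinFunctor.hom_ext fun (X : ULiftHom.{u + 1} A.unop.carrier) =>
      ULift.ext _ _ <| by
        have h := atGeneric_classifyPullbackIso_app f.unop X
        exact (conj_counit f.unop.upperStar.obj _ _).trans
          congr((𝟙 _ ≫ $h ≫ 𝟙 _ ≫ 𝟙 _ ≫ 𝟙 _) ≫ _).symm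

/-- A flat morphism is the classifying morphism of the pullback of the generic object. -/
noncomputable def evalCompClassifyIso (A : GrtFlat.{u} k) :
    LinFunctor.id k (FlatMorphism A (objectClassifier k)) ≅ (evalGeneric A).comp (classify A) :=
  ObjectProperty.isoMk _ (NatIso.ofComponents
    (fun f => isoOfGeneric (f := f) (classifyingIso _).symm)
    fun {f g} η => hom_ext_of_atGeneric <| by
      have h₁ := atGeneric_homOfGeneric (f := f) (classifyingIso (A := A) _).inv
      have h₂ := atGeneric_homOfGeneric (f := g) (classifyingIso (A := A) _).inv
      have h₃ := atGeneric_classify_map ((evalGeneric A).obj.map η)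
      exact congr(_ ≫ $h₂).trans
        ((conj_unit_naturality (atGeneric η) _ _).trans congr($h₁ ≫ $h₃).symm))

variable (k) in
/-- Evaluation at the generic object is inverse to classifying morphisms. -/
noncomputable def evalCompClassify :
    𝟙 (GrtFlat.homTo (objectClassifier k)) ≅ evalGenericTrans k ≫ classifyTrans k :=
  Pseudofunctor.StrongTrans.isoMk (fun A => evalCompClassifyIso A.unop)
    fun {A B} f => LinFunctor.hom_ext fun g => hom_ext_of_atGeneric <| by
      let X := (evalGeneric A.unop).obj.obj g
      have h₁ := atGeneric_homOfGeneric (f := g) (classifyingIso (A := A.unop) _).inv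
      have h₂ := atGeneric_homOfGeneric (f := f.unop.comp g) (classifyingIso (A := B.unop) _).inv
      have h₃ := atGeneric_classify_map (𝟙 (f.unop.upperStar.uliftHom.obj.obj X))
      have h₄ := atGeneric_classifyPullbackIso_app f.unop X
      exact congr($h₂ ≫ 𝟙 _ ≫ $h₃ ≫ 𝟙 _ ≫ $h₄ ≫ 𝟙 _).trans
        ((conj_unit f.unop.upperStar.obj _ _).trans
          congr((𝟙 _ ≫ 𝟙 _) ≫ f.unop.upperStar.obj.map $h₁).symm)

end Representability

end LinearCat

theorem mainTheorem8 (k : Type u) [CommRing k] :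
    Nonempty (CategoryTheory.Bicategory.Equivalence
      (LinearCat.GrtFlat.homTo (LinearCat.objectClassifier k)) (LinearCat.GrtFlat.forget k)) :=
  -- The two invertible modifications need not satisfy the triangle identity; the counit is adjusted
  -- so that they form an adjoint equivalence.
  ⟨.mkOfAdjointifyCounit (LinearCat.evalCompClassify k) (LinearCat.classifyCompEval k)⟩
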